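/- Let $\mathbb O$ be the algebra of complex octonions with its multiplicative norm form $N$, let $\mathbb E$ be the $27$-dimensional complex exceptional Jordan algebra of Hermitian $3\times3$ octonionic matrices, let $G\subset \mathrm{GL}(\mathbb E)$ be the group of linear automorphisms preserving the determinant (the simply connected complex group of type $E_6$ in its minuscule representation), and let $\mathfrak g\subset\mathrm{End}(\mathbb E)$ be its Lie algebra. Let $z\in\mathfrak g$ be the semisimple element $4L_e-\frac43$, where $L_e$ is Jordan multiplication by the idempotent $e=\mathrm{diag}(1,0,0)$. The eigenvalues of $z$ on $\mathbb E$ are $\frac83,\frac23,-\frac43$; let $\mathbb E=\mathbb E_0\oplus\mathbb E_1\oplus\mathbb E_2$ be the corresponding decomposition into eigenspaces, of dimensions $1,16,10$. The eigenvalues of $\mathrm{ad}(z)$ on $\mathfrak g$ are $2,0,-2$; let $\mathfrak u_+$ and $\mathfrak u_-$ be its eigenspaces for $2$ and $-2$. Let $K$ be the centralizer of $z$ in $G$ (the complexification of a maximal compact subgroup of the real form $E_{6(-14)}$) and let $\mathrm{Spin}_{10}=[K,K]$ be its derived subgroup. An element $y\in\mathfrak u_-$ is said to have rank $r$ if it is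 $K$-conjugate to a sum $y_{\alpha_1}+\dots+y_{\alpha_r}$, where $\alpha_1,\dots,\alpha_r$ are strongly orthogonal roots of $\mathfrak u_+$ with respect to a fixed Cartan subalgebra $\mathfrak t\ni z$ of $\mathfrak g$ (linearly independent roots such that $\alpha_i\pm\alpha_j$ is not a root for $i\neq j$) and $y_{\alpha_i}$ is a nonzero vector of the root space $\mathfrak g_{-\alpha_i}$. For $y\in\mathfrak u_-$ let $\lambda_2(y):\mathbb E_1\to\mathbb E_2$ be the linear map given by the action of $y$. Fix a nonzero vector $e_0\in\mathbb E_0$. Then the following hold. (0) The map $\mathfrak u_-\to\mathbb E_1$, $y\mapsto y\cdot e_0$, is a linear isomorphism. Let $\alpha:\mathbb E_1\to\mathfrak u_-$ be its inverse. For $x\in\mathbb E_1$, define $\kappa(x)=\alpha(x)\cdot x\in\mathbb E_2$, write $\lambda_2(x)=\lambda_2(\alpha(x))$, and call the rank of $\alpha(x)$ the rank of $x$. The quadratic map $\kappa:\mathbb E_1\to\mathbb E_2$ is $\mathrm{Spin}_{10}$-equivariant, and there are linear isomorphisms $\mathbb E_1\simeq\mathbb O\oplus\mathbb O$ and $\mathbb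 E_2\simeq\mathbb C\oplus\mathbb O\oplus\mathbb C$ under which $\kappa(u,v)=(N(u),uv,N(v))$. Let $x,y\in\mathbb E_1$ be nonzero. (a) $x$ has rank one if and only if $\kappa(x)=0$. (b) $x$ has rank one if and only if $\lambda_2(x)$ has rank $5$. (c) $x$ has rank two if and only if $\lambda_2(x)$ has rank $9$. (d) If every nontrivial linear combination of $x$ and $y$ has rank two, then $\dim(\ker\lambda_2(x)\cap\ker\lambda_2(y))\le 3$. (e) If $x$ and $y$ have rank one and $\dim(\operatorname{im}\lambda_2(x)\cap\operatorname{im}\lambda_2(y))\ge 4$, then $x$ and $y$ are proportional. -/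

import Mathlib

open scoped Matrix

noncomputable section

/-! ### Complex octonions -/

/-- The complex octonions, realised as Zorn's vector matrices: `(a, b, v, w)` stands for the
"matrix" with diagonal scalars `a, b ∈ ℂ` and off-diagonal vectors `v, w ∈ ℂ³`.
The octonion product is `Oct.mul` below (it is *not* the componentwise product). -/
abbrev Oct : Type := ℂ × ℂ × (Fin 3 → ℂ) × (Fin 3 → ℂ)

/-- The octonion product. -/
def Oct.mul : Oct → Oct → Oct
  | (a, b, v, w), (a', b', v', w') =>
    (a * a' + v ⬝ᵥ w',
     b * b' + w ⬝ᵥ v',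
     a • v' + b' • v - crossProduct w w',
     a' • w + b • w' + crossProduct v v')

/-- The (multiplicative) norm form of the octonions. -/
def Oct.norm : Oct → ℂ
  | (a, b, v, w) => a * b - v ⬝ᵥ w

/-- The trace form of the octonions. -/
def Oct.tr (x : Oct) : ℂ := x.1 + x.2.1

/-- The standard basis of the octonions. -/
def Oct.basis : Module.Basis (Unit ⊕ Unit ⊕ Fin 3 ⊕ Fin 3) ℂ Oct :=
  (Module.Basis.singleton Unit ℂ).prod
    ((Module.Basis.singleton Unit ℂ).prod
      ((Pi.basisFun ℂ (Fin 3)).prod (Pi.basisFun ℂ (Fin 3))))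

theorem Oct.norm_mul (x y : Oct) : (x.mul y).norm = x.norm * y.norm := by
  obtain ⟨a, b, v, w⟩ := x
  obtain ⟨c, d, p, q⟩ := y
  simp only [Oct.mul, Oct.norm, cross_apply, dotProduct, Fin.sum_univ_three, Pi.add_apply,
    Pi.sub_apply, Pi.smul_apply, smul_eq_mul, Matrix.cons_val]
  ring

/-- The polarisation of the norm form. -/
def Oct.inner : Oct → Oct → ℂ
  | (a, b, v, w), (a', b', v', w') => a * b' + a' * b - v ⬝ᵥ w' - v' ⬝ᵥ w

theorem Oct.norm_add (x y : Oct) : (x + y).norm = x.norm + y.norm + x.inner y := by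
  obtain ⟨a, b, v, w⟩ := x
  obtain ⟨c, d, p, q⟩ := y
  simp only [Oct.inner, Oct.norm, Prod.mk_add_mk, add_dotProduct, dotProduct_add]
  ring

theorem Oct.norm_smul (c : ℂ) (x : Oct) : (c • x).norm = c ^ 2 * x.norm := by
  obtain ⟨a, b, v, w⟩ := x
  simp only [Oct.norm, Prod.smul_mk, smul_dotProduct, dotProduct_smul, smul_eq_mul]
  ring

theorem Oct.inner_comm (x y : Oct) : x.inner y = y.inner x := by
  obtain ⟨a, b, v, w⟩ := x
  obtain ⟨c, d, p, q⟩ := y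
  simp only [Oct.inner]
  ring

theorem Oct.inner_add_left (x y z : Oct) : (x + y).inner z = x.inner z + y.inner z := by
  obtain ⟨a, b, v, w⟩ := x
  obtain ⟨c, d, p, q⟩ := y
  obtain ⟨e, f, r, s⟩ := z
  simp only [Oct.inner, Prod.mk_add_mk, add_dotProduct, dotProduct_add]
  ring

theorem Oct.inner_smul_left (c : ℂ) (x y : Oct) : (c • x).inner y = c * x.inner y := by
  obtain ⟨a, b, v, w⟩ := x
  obtain ⟨c, d, p, q⟩ := y
  simp only [Oct.inner, Prod.smul_mk, smul_dotProduct, dotProduct_smul, smul_eq_mul]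
  ring

theorem Oct.inner_self (x : Oct) : x.inner x = 2 * x.norm := by
  obtain ⟨a, b, v, w⟩ := x
  simp only [Oct.inner, Oct.norm]
  ring

theorem Oct.add_mul (x y z : Oct) : (x + y).mul z = x.mul z + y.mul z := by
  obtain ⟨a, b, v, w⟩ := x
  obtain ⟨c, d, p, q⟩ := y
  obtain ⟨e, f, r, s⟩ := z
  simp only [Oct.mul, Prod.mk_add_mk, add_dotProduct, dotProduct_add, map_add,
    LinearMap.add_apply, Prod.mk.injEq]
  refine ⟨by ring, by ring, by module, by module⟩

theorem Oct.mul_add (x y z : Oct) : x.mul (y + z) = x.mul y + x.mul z := by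
  obtain ⟨a, b, v, w⟩ := x
  obtain ⟨c, d, p, q⟩ := y
  obtain ⟨e, f, r, s⟩ := z
  simp only [Oct.mul, Prod.mk_add_mk, add_dotProduct, dotProduct_add, map_add, Prod.mk.injEq]
  refine ⟨by ring, by ring, by module, by module⟩

theorem Oct.smul_mul (k : ℂ) (x y : Oct) : (k • x).mul y = k • x.mul y := by
  obtain ⟨a, b, v, w⟩ := x
  obtain ⟨c, d, p, q⟩ := y
  simp only [Oct.mul, Prod.smul_mk, smul_dotProduct, dotProduct_smul, map_smul, smul_eq_mul,
    LinearMap.smul_apply, Prod.mk.injEq]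
  refine ⟨by ring, by ring, by module, by module⟩

theorem Oct.mul_smul (k : ℂ) (x y : Oct) : x.mul (k • y) = k • x.mul y := by
  obtain ⟨a, b, v, w⟩ := x
  obtain ⟨c, d, p, q⟩ := y
  simp only [Oct.mul, Prod.smul_mk, smul_dotProduct, dotProduct_smul, map_smul, smul_eq_mul,
    Prod.mk.injEq]
  refine ⟨by ring, by ring, by module, by module⟩

theorem Oct.tr_add (x y : Oct) : (x + y).tr = x.tr + y.tr := by
  simp only [Oct.tr, Prod.fst_add, Prod.snd_add]
  ring

theorem Oct.tr_smul (k : ℂ) (x : Oct) : (k • x).tr = k * x.tr := by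
  simp only [Oct.tr, Prod.smul_fst, Prod.smul_snd, smul_eq_mul]
  ring

/-! ### The exceptional Jordan algebra and its cubic form -/

/-- The `27`-dimensional complex exceptional Jordan algebra: `(ξ, a)` stands for the Hermitian
`3 × 3` octonionic matrix with diagonal entries `ξ 0, ξ 1, ξ 2 ∈ ℂ` and off-diagonal entries
`a 0` in position `(1,2)`, `a 1` in position `(2,0)`, `a 2` in position `(0,1)`
(and their conjugates in the transposed positions). -/
abbrev Jordan : Type := (Fin 3 → ℂ) × (Fin 3 → Oct)

/-- The determinant (cubic norm) of the exceptional Jordan algebra. -/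
def Jordan.det (x : Jordan) : ℂ :=
  x.1 0 * x.1 1 * x.1 2 - ∑ i, x.1 i * (x.2 i).norm
    + (((x.2 0).mul (x.2 1)).mul (x.2 2)).tr

/-- The full polarisation of the determinant: the symmetric trilinear form with
`polar x x x = 6 * det x`. -/
def Jordan.polar (x y z : Jordan) : ℂ :=
  det (x + y + z) - det (x + y) - det (y + z) - det (x + z) + det x + det y + det z

/-- The standard basis of the exceptional Jordan algebra. -/
def Jordan.basis :
    Module.Basis (Fin 3 ⊕ (Σ _ : Fin 3, Unit ⊕ Unit ⊕ Fin 3 ⊕ Fin 3)) ℂ Jordan :=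
  (Pi.basisFun ℂ (Fin 3)).prod (Pi.basis fun _ => Oct.basis)

/-- The trilinear form `tr ((x y) z)` on the octonions. -/
def Oct.tri (x y z : Oct) : ℂ := ((x.mul y).mul z).tr

theorem Jordan.polar_eq (x y z : Jordan) :
    polar x y z =
      x.1 0 * y.1 1 * z.1 2 + x.1 0 * z.1 1 * y.1 2 + y.1 0 * x.1 1 * z.1 2
      + y.1 0 * z.1 1 * x.1 2 + z.1 0 * x.1 1 * y.1 2 + z.1 0 * y.1 1 * x.1 2
      - ∑ i, (x.1 i * (y.2 i).inner (z.2 i) + y.1 i * (x.2 i).inner (z.2 i)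
          + z.1 i * (x.2 i).inner (y.2 i))
      + (Oct.tri (x.2 0) (y.2 1) (z.2 2) + Oct.tri (x.2 0) (z.2 1) (y.2 2)
        + Oct.tri (y.2 0) (x.2 1) (z.2 2) + Oct.tri (y.2 0) (z.2 1) (x.2 2)
        + Oct.tri (z.2 0) (x.2 1) (y.2 2) + Oct.tri (z.2 0) (y.2 1) (x.2 2)) := by
  simp only [polar, det, Oct.tri, Fin.sum_univ_three, Prod.fst_add, Prod.snd_add, Pi.add_apply,
    Oct.norm_add, Oct.inner_add_left, Oct.add_mul, Oct.mul_add, Oct.tr_add]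
  ring

theorem Jordan.polar_add (x x' y z : Jordan) :
    polar (x + x') y z = polar x y z + polar x' y z := by
  have h : ∀ a b c : Oct, a.inner (b + c) = a.inner b + a.inner c := fun a b c => by
    rw [Oct.inner_comm, Oct.inner_add_left, Oct.inner_comm b, Oct.inner_comm c]
  simp only [polar_eq, Oct.tri, Fin.sum_univ_three, Prod.fst_add, Prod.snd_add, Pi.add_apply,
    Oct.inner_add_left, h, Oct.add_mul, Oct.mul_add, Oct.tr_add]
  ring

theorem Jordan.polar_smul (c : ℂ) (x y z : Jordan) :
    polar (c • x) y z = c * polar x y z := by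
  simp only [polar_eq, Oct.tri, Fin.sum_univ_three, Prod.smul_fst, Prod.smul_snd, Pi.smul_apply,
    Oct.inner_smul_left, Oct.smul_mul, Oct.mul_smul, Oct.tr_smul, smul_eq_mul]
  ring

theorem Jordan.polar_swap (x y z : Jordan) : polar x y z = polar y x z := by
  unfold polar
  rw [add_comm x y]
  ring

theorem Jordan.polar_rotate (x y z : Jordan) : polar x y z = polar y z x := by
  unfold polar
  rw [show x + y + z = y + z + x by abel, add_comm x y, add_comm x z]
  ring

theorem Jordan.polar_diag (x : Jordan) : polar x x x = 6 * det x := by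
  simp only [polar_eq, det, Oct.tri, Fin.sum_univ_three, Oct.inner_self]
  ring

namespace E6

/-! ### The group and the Lie algebra of type `E₆` and their minuscule representation -/

/-- The simply connected complex group of type `E₆` in its minuscule `27`-dimensional
representation: the linear automorphisms preserving the determinant. -/
def G : Subgroup (Jordan ≃ₗ[ℂ] Jordan) where
  carrier := {g | ∀ x, Jordan.det (g x) = Jordan.det x}
  one_mem' := fun _ => rfl
  mul_mem' := fun {g h} hg hh x => (hg (h x)).trans (hh x)
  inv_mem' := fun {g} hg x => by
    have h := hg (g.symm x)
    rw [LinearEquiv.apply_symm_apply] at h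
    exact h.symm

/-- The Lie algebra of `G`: the endomorphisms that preserve the polarised determinant
infinitesimally. -/
def g : Submodule ℂ (Module.End ℂ Jordan) where
  carrier := {A | ∀ x y z,
    Jordan.polar (A x) y z + Jordan.polar x (A y) z + Jordan.polar x y (A z) = 0}
  zero_mem' := fun x y z => by
    have h0 : ∀ y z, Jordan.polar 0 y z = 0 := fun y z => by
      simpa using Jordan.polar_smul 0 0 y z
    simp only [LinearMap.zero_apply]
    rw [Jordan.polar_swap x 0 z, ← Jordan.polar_rotate 0 x y, h0, h0, h0]
    simp
  add_mem' := fun {A B} hA hB x y z => by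
    have h1 := hA x y z
    have h2 := hB x y z
    simp only [LinearMap.add_apply]
    rw [Jordan.polar_swap x (A y + B y), ← Jordan.polar_rotate (A z + B z), Jordan.polar_add,
      Jordan.polar_add, Jordan.polar_add]
    rw [Jordan.polar_swap x (A y), ← Jordan.polar_rotate (A z)] at h1
    rw [Jordan.polar_swap x (B y), ← Jordan.polar_rotate (B z)] at h2
    linear_combination h1 + h2
  smul_mem' := fun c A hA x y z => by
    have h1 := hA x y z
    simp only [LinearMap.smul_apply]
    rw [Jordan.polar_swap x (c • A y), ← Jordan.polar_rotate (c • A z), Jordan.polar_smul,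
      Jordan.polar_smul, Jordan.polar_smul]
    rw [Jordan.polar_swap x (A y), ← Jordan.polar_rotate (A z)] at h1
    linear_combination c * h1

/-- `g` is a Lie algebra for the commutator `⁅A, B⁆ = A * B - B * A` of endomorphisms. -/
theorem commutator_mem_g {A B : Module.End ℂ Jordan} (hA : A ∈ g) (hB : B ∈ g) :
    A * B - B * A ∈ g := fun x y z => by
  have hsub : ∀ a b y z, Jordan.polar (a - b) y z = Jordan.polar a y z - Jordan.polar b y z :=
    fun a b y z => by
      have := Jordan.polar_add (a - b) b y z
      rw [sub_add_cancel] at this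
      linear_combination -this
  have e : ∀ u, (A * B - B * A) u = A (B u) - B (A u) := fun _ => rfl
  simp only [e]
  rw [Jordan.polar_swap x (A (B y) - B (A y)), ← Jordan.polar_rotate (A (B z) - B (A z)),
    hsub, hsub, hsub, ← Jordan.polar_swap x (A (B y)), ← Jordan.polar_swap x (B (A y)),
    Jordan.polar_rotate (A (B z)), Jordan.polar_rotate (B (A z))]
  linear_combination hA (B x) y z + hA x (B y) z + hA x y (B z)
    - hB (A x) y z - hB x (A y) z - hB x y (A z)

/-- The Cartan subalgebra of `g` consisting of the elements which are diagonal in the standard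
basis, the Lie algebra of the maximal torus `T` of diagonal elements of `G`. -/
def t : Submodule ℂ (Module.End ℂ Jordan) where
  carrier := {h | h ∈ g ∧ (LinearMap.toMatrix Jordan.basis Jordan.basis h).IsDiag}
  zero_mem' := ⟨g.zero_mem, by simp⟩
  add_mem' := fun {a b} ha hb => ⟨g.add_mem ha.1 hb.1, by
    rw [map_add]; exact ha.2.add hb.2⟩
  smul_mem' := fun c a ha => ⟨g.smul_mem c ha.1, by
    rw [map_smul]; exact ha.2.smul c⟩

/-- The element `z` which spans the centre of `𝔨` for the real form `E₆₍₋₁₄₎`, normalised so that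
`ad z` has the eigenvalues `2, 0, -2` on `g`.
With `e` the idempotent `diag(1,0,0)`, it is `4 L_e - 4/3`, where `L_e` is Jordan multiplication
by `e`, which has the eigenvalues `1, 1/2, 0`. -/
def z : Module.End ℂ Jordan :=
  LinearMap.prodMap
    (LinearMap.pi fun i => (![8 / 3, -4 / 3, -4 / 3] i : ℂ) • LinearMap.proj i)
    (LinearMap.pi fun i => (![-4 / 3, 2 / 3, 2 / 3] i : ℂ) • LinearMap.proj i)

theorem z_mem_g : z ∈ g := by
  have h : ∀ (c : ℂ) (a b : Oct), a.inner (c • b) = c * a.inner b := fun c a b => by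
    rw [Oct.inner_comm, Oct.inner_smul_left, Oct.inner_comm b]
  intro x y w
  simp only [z, Jordan.polar_eq, Oct.tri, Fin.sum_univ_three, LinearMap.prodMap_apply,
    LinearMap.pi_apply, LinearMap.smul_apply, LinearMap.proj_apply, Matrix.cons_val,
    Oct.inner_smul_left, h, Oct.smul_mul, Oct.mul_smul, Oct.tr_smul, smul_eq_mul]
  ring

theorem z_mem_t : z ∈ t := by
  refine ⟨z_mem_g, fun i j hij => ?_⟩
  change LinearMap.toMatrix Jordan.basis Jordan.basis z i j = 0
  rw [LinearMap.toMatrix_apply]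
  rcases i with i | ⟨i, i'⟩ <;> rcases j with j | ⟨j, j'⟩
  · have : i ≠ j := fun h => hij (by rw [h])
    simp [z, Jordan.basis, this]
  · simp [z, Jordan.basis]
  · simp [z, Jordan.basis]
  · by_cases hi : i = j
    · subst hi
      have : i' ≠ j' := fun h => hij (by rw [h])
      simp [z, Jordan.basis, this]
    · simp [z, Jordan.basis, hi]

/-- The group `K`, the complexified maximal compact subgroup of `E₆₍₋₁₄₎`: the centraliser of `z`
in `G`. -/
def K : Subgroup (Jordan ≃ₗ[ℂ] Jordan) where
  carrier := {k | k ∈ G ∧ ∀ x, k (z x) = z (k x)}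
  one_mem' := ⟨G.one_mem, fun _ => rfl⟩
  mul_mem' := fun {k l} hk hl => ⟨G.mul_mem hk.1 hl.1, fun x => by
    change k (l (z x)) = z (k (l x))
    rw [hl.2, hk.2]⟩
  inv_mem' := fun {k} hk => ⟨G.inv_mem hk.1, fun x => by
    change k.symm (z x) = z (k.symm x)
    rw [LinearEquiv.symm_apply_eq, hk.2, LinearEquiv.apply_symm_apply]⟩

/-- The group `Spin₁₀`: the derived subgroup of `K`
(`K` is the product of `Spin₁₀` and of its one-dimensional centre). -/
def Spin10 : Subgroup (Jordan ≃ₗ[ℂ] Jordan) := ⁅K, K⁆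

/-- `𝔲₋`, the eigenspace of `ad z` on `g` for the eigenvalue `-2`. -/
def uMinus : Submodule ℂ (Module.End ℂ Jordan) where
  carrier := {A | A ∈ g ∧ z * A - A * z = (-2 : ℂ) • A}
  zero_mem' := ⟨g.zero_mem, by simp⟩
  add_mem' := fun {A B} hA hB => ⟨g.add_mem hA.1 hB.1, by
    rw [smul_add, ← hA.2, ← hB.2, mul_add, add_mul]
    abel⟩
  smul_mem' := fun c A hA => ⟨g.smul_mem c hA.1, by
    rw [smul_comm, ← hA.2, mul_smul_comm, smul_mul_assoc, smul_sub]⟩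

/-- The grading of the representation: `𝔼ᵢ` is the eigenspace of `z` for the eigenvalue
`z_max - 2 i`, where `z_max = 8/3` is the highest eigenvalue.
Thus `𝔼₀, 𝔼₁, 𝔼₂` have dimension `1, 16, 10`. -/
def E (i : ℕ) : Submodule ℂ Jordan := Module.End.eigenspace z (8 / 3 - 2 * (i : ℂ))

theorem uMinus_mapsTo {A : Module.End ℂ Jordan} (hA : A ∈ uMinus) (i : ℕ) {v : Jordan}
    (hv : v ∈ E i) : A v ∈ E (i + 1) := by
  rw [E, Module.End.mem_eigenspace_iff] at hv ⊢
  have h := LinearMap.congr_fun hA.2 v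
  change z (A v) - A (z v) = (-2 : ℂ) • A v at h
  rw [hv, map_smul] at h
  rw [sub_eq_iff_eq_add.mp h, ← add_smul]
  congr 1
  push_cast
  ring

/-- The linear map `λ₂(y) : 𝔼₁ → 𝔼₂` defined by `y ∈ 𝔲₋`. -/
def lambda₂ (y : uMinus) : E 1 →ₗ[ℂ] E 2 :=
  (y : Module.End ℂ Jordan).restrict fun _ hv => uMinus_mapsTo y.2 1 hv

/-- The quadratic map `κ : 𝔼₁ → 𝔼₂`, `κ(x) = α(x) · x`, for an identification `α : 𝔼₁ ≃ 𝔲₋`. -/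
def kappa (α : E 1 ≃ₗ[ℂ] uMinus) (x : E 1) : E 2 := lambda₂ (α x) x

/-! ### Roots and the rank of an element of `𝔲₋` -/

/-- The root space `g_α` of a linear form `α` on the Cartan subalgebra `t`. -/
def rootSpace (α : Module.Dual ℂ t) : Set (Module.End ℂ Jordan) :=
  {A | A ∈ g ∧ ∀ h : t,
    (h : Module.End ℂ Jordan) * A - A * (h : Module.End ℂ Jordan) = α h • A}

/-- `α` is a root of `g` with respect to `t`. -/
def IsRoot (α : Module.Dual ℂ t) : Prop := α ≠ 0 ∧ ∃ A ∈ rootSpace α, A ≠ 0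

/-- `α 0, …, α (r-1)` are strongly orthogonal roots of `𝔲₊`: linearly independent roots, with
`⟨αᵢ, z⟩ = 2`, such that no `αᵢ ± αⱼ` with `i ≠ j` is a root.
(All roots are long, since `E₆` is simply laced.) -/
def StronglyOrthogonal {r : ℕ} (α : Fin r → Module.Dual ℂ t) : Prop :=
  (∀ i, IsRoot (α i) ∧ α i ⟨z, z_mem_t⟩ = 2) ∧ LinearIndependent ℂ α ∧
    ∀ i j, i ≠ j → ¬ IsRoot (α i + α j) ∧ ¬ IsRoot (α i - α j)

/-- `y ∈ 𝔲₋` has rank `r`: it lies in the `K`-orbit of some `y_{α₁} + ⋯ + y_{αᵣ}`, where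
`α₁, …, αᵣ` are strongly orthogonal roots of `𝔲₊` and `y_{αᵢ}` is a nonzero element of the root
space of `-αᵢ`. -/
def HasRank (y : uMinus) (r : ℕ) : Prop :=
  ∃ k ∈ K, ∃ α : Fin r → Module.Dual ℂ t, StronglyOrthogonal α ∧
    ∃ e : Fin r → Module.End ℂ Jordan, (∀ i, e i ∈ rootSpace (-α i) ∧ e i ≠ 0) ∧
      (y : Module.End ℂ Jordan) = k.conj (∑ i, e i)

end E6

end

noncomputable section

/-! ### Conjugation and further identities of the octonions -/

namespace Oct

/-! The argument turns every assertion into octonionic coordinates and then into a computation at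
two normal forms.

Invariance of the determinant makes an element of `uMinus` recoverable from its value on the top
vector (`uMinus_eq_zero`, `eq_lower`). So 𝔲₋ consists of the explicit operators `lower (deg1 u v)`.
With e₀ = `deg0 c`, α(x) = `lower (c⁻¹ • x)`, and up to a scalar, order and conjugation κ(u, v) is
(N(u), uv, N(v)) (`lower_lower`). Elements k of K fixing the top vector satisfy k `lower x` k⁻¹ =
`lower (k x)` (`conj_lower`, `lower_map`). Commutators in K fix it because K acts by scalars on the
line 𝔼₀. This gives the equivariance of κ.

Transvections and a transposition in K fix the top vector and reduce every nonzero (u, v) to one of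
two forms: (1, 0) if κ ≠ 0 (`equivalent_unit`), and (f, 0) with f a primitive idempotent if κ = 0
(`equivalent_idem`). The tools are composition of norms, alternativity, and the fact that uv = 0
with u ≠ 0 puts v in ūO.

Ranks match this dichotomy. A generic torus element with distinct weights shows that root vectors of
𝔲₋ are multiples of `lower` at standard basis vectors, where κ vanishes. For two strongly orthogonal
roots the mixed term of κ is nonzero, since a commutator of root vectors must vanish
(`lower_basis_mul_ne_zero`). Conversely f is a basis vector and 1 is a sum of two, whose roots are
strongly orthogonal. Hence `hasRank_one_iff` and `hasRank_two_iff`; the ranks 5 and 9 of λ₂ are read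
off at the normal forms.

For (d), normalise x to (1, 0) and y to (p, q). If q = 0, a quadratic equation gives a combination
with κ = 0. Otherwise the common kernel lies in the traceless part of {b : bq = 0}, a totally
isotropic space of dimension at most 4, and is smaller by one (`finrank_commonKernel_unit`). For
(e), normalise x to (f, 0): the common image has codimension at most one in im λ₂(x), and the
equations satisfied by im λ₂(y) force y to be a multiple of x (`eq_smul_of_finrank_idem`). -/

theorem ext_coords {x y : Oct} (h₁ : x.1 = y.1) (h₂ : x.2.1 = y.2.1)
    (h₃ : ∀ i, x.2.2.1 i = y.2.2.1 i) (h₄ : ∀ i, x.2.2.2 i = y.2.2.2 i) : x = y :=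
  Prod.ext h₁ (Prod.ext h₂ (Prod.ext (funext h₃) (funext h₄)))

/-- The octonion conjugation. -/
def conj : Oct →ₗ[ℂ] Oct where
  toFun x := (x.2.1, x.1, -x.2.2.1, -x.2.2.2)
  map_add' x y := by
    apply ext_coords <;> simp [add_comm]
  map_smul' c x := by
    apply ext_coords <;> simp

/-- The unit of the octonions. -/
def unit : Oct := (1, 1, 0, 0)

theorem conj_apply (x : Oct) : conj x = (x.2.1, x.1, -x.2.2.1, -x.2.2.2) := rfl

theorem conj_conj (x : Oct) : conj (conj x) = x := by
  simp [conj_apply]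

theorem conj_injective : Function.Injective conj := fun x y h => by
  rw [← conj_conj x, h, conj_conj]

theorem norm_conj (x : Oct) : (conj x).norm = x.norm := by
  obtain ⟨a, b, v, w⟩ := x
  simp [norm, conj_apply, mul_comm]

theorem unit_mul (x : Oct) : unit.mul x = x := by
  obtain ⟨a, b, v, w⟩ := x
  simp [unit, mul]

theorem norm_unit : unit.norm = 1 := by simp [unit, norm]

theorem zero_mul (x : Oct) : mul 0 x = 0 := by
  simpa using smul_mul 0 0 x

theorem mul_zero (x : Oct) : mul x 0 = 0 := by
  simpa using mul_smul 0 x 0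

theorem inner_add_right (x y z : Oct) : x.inner (y + z) = x.inner y + x.inner z := by
  rw [inner_comm, inner_add_left, inner_comm y, inner_comm z]

theorem inner_smul_right (c : ℂ) (x y : Oct) : x.inner (c • y) = c * x.inner y := by
  rw [inner_comm, inner_smul_left, inner_comm y]

theorem zero_inner (x : Oct) : inner 0 x = 0 := by
  simpa using inner_smul_left 0 0 x

theorem inner_zero (x : Oct) : inner x 0 = 0 := by
  rw [inner_comm, zero_inner]

theorem norm_zero : norm 0 = 0 := by
  simpa using norm_smul 0 0

theorem conj_mul (x y : Oct) : conj (x.mul y) = (conj y).mul (conj x) := by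
  obtain ⟨a, b, v, w⟩ := x
  obtain ⟨a', b', v', w'⟩ := y
  apply ext_coords
  · simp only [mul, conj_apply, dotProduct, Fin.sum_univ_three, Pi.neg_apply]
    ring
  · simp only [mul, conj_apply, dotProduct, Fin.sum_univ_three, Pi.neg_apply]
    ring
  · intro i
    fin_cases i <;> simp [mul, conj_apply, cross_apply] <;> ring
  · intro i
    fin_cases i <;> simp [mul, conj_apply, cross_apply] <;> ring

theorem tr_mul_conj (x y : Oct) : (x.mul (conj y)).tr = x.inner y := by
  obtain ⟨a, b, v, w⟩ := x
  obtain ⟨a', b', v', w'⟩ := y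
  simp only [mul, conj_apply, tr, inner, dotProduct, Fin.sum_univ_three, Pi.neg_apply]
  ring

theorem tr_conj (x : Oct) : (conj x).tr = x.tr := by
  simp [tr, conj_apply, add_comm]

theorem inner_conj (x y : Oct) : (conj x).inner (conj y) = x.inner y := by
  simp [inner, conj_apply, dotProduct, Fin.sum_univ_three]
  ring

/-- Polarised left alternativity. -/
theorem conj_mul_mul_add (x y z : Oct) :
    (conj x).mul (y.mul z) + (conj y).mul (x.mul z) = x.inner y • z := by
  obtain ⟨a, b, v, w⟩ := x
  obtain ⟨a', b', v', w'⟩ := y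
  obtain ⟨c, d, p, q⟩ := z
  apply ext_coords
  · simp [mul, conj_apply, inner, cross_apply, dotProduct, Fin.sum_univ_three, Matrix.vecHead,
        Matrix.vecTail]
    ring
  · simp [mul, conj_apply, inner, cross_apply, dotProduct, Fin.sum_univ_three, Matrix.vecHead,
        Matrix.vecTail]
    ring
  · intro i
    fin_cases i <;>
      simp [mul, conj_apply, inner, cross_apply, dotProduct, Fin.sum_univ_three, Matrix.vecHead,
        Matrix.vecTail] <;> ring
  · intro i
    fin_cases i <;>
      simp [mul, conj_apply, inner, cross_apply, dotProduct, Fin.sum_univ_three, Matrix.vecHead,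
        Matrix.vecTail] <;> ring

/-- Polarised right alternativity. -/
theorem mul_mul_conj_add (x y z : Oct) :
    (z.mul x).mul (conj y) + (z.mul y).mul (conj x) = x.inner y • z := by
  apply conj_injective
  simp only [map_add, conj_mul, map_smul, conj_conj]
  rw [← inner_conj]
  have := conj_mul_mul_add (conj x) (conj y) (conj z)
  rw [conj_conj, conj_conj] at this
  rw [← this, add_comm]

theorem conj_mul_mul (x z : Oct) : (conj x).mul (x.mul z) = x.norm • z := by
  have h := conj_mul_mul_add x x z
  rw [inner_self, ← two_smul ℂ, SemigroupAction.mul_smul] at h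
  exact smul_right_injective _ (two_ne_zero (α := ℂ)) h

theorem mul_mul_conj (x z : Oct) : (z.mul x).mul (conj x) = x.norm • z := by
  have h := mul_mul_conj_add x x z
  rw [inner_self, ← two_smul ℂ, SemigroupAction.mul_smul] at h
  exact smul_right_injective _ (two_ne_zero (α := ℂ)) h

theorem mul_conj_mul (x z : Oct) : x.mul ((conj x).mul z) = x.norm • z := by
  have := conj_mul_mul (conj x) z
  rwa [conj_conj, norm_conj] at this

theorem mul_conj_mul' (x z : Oct) : (z.mul (conj x)).mul x = x.norm • z := by
  have := mul_mul_conj (conj x) z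
  rwa [conj_conj, norm_conj] at this

/-- The trace form is associative. -/
theorem tri_eq (x y z : Oct) : tri x y z = (x.mul (y.mul z)).tr := by
  obtain ⟨a, b, v, w⟩ := x
  obtain ⟨a', b', v', w'⟩ := y
  obtain ⟨c, d, p, q⟩ := z
  simp [tri, mul, tr, cross_apply, dotProduct, Fin.sum_univ_three, Matrix.vecHead,
    Matrix.vecTail]
  ring

theorem tr_mul_comm (x y : Oct) : (x.mul y).tr = (y.mul x).tr := by
  obtain ⟨a, b, v, w⟩ := x
  obtain ⟨a', b', v', w'⟩ := y
  simp only [mul, tr, dotProduct, Fin.sum_univ_three]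
  ring

theorem tri_rotate (x y z : Oct) : tri x y z = tri y z x := by
  rw [tri_eq, tr_mul_comm]
  rfl

theorem tri_eq_inner (x y z : Oct) : tri x y z = x.inner (conj (y.mul z)) := by
  rw [tri_eq, ← tr_mul_conj, conj_conj]

/-- The norm form is nondegenerate. -/
theorem eq_zero_of_inner {x : Oct} (h : ∀ y, x.inner y = 0) : x = 0 := by
  apply ext_coords
  · simpa [inner] using h (0, 1, 0, 0)
  · simpa [inner] using h (1, 0, 0, 0)
  · intro i
    simpa [inner] using h (0, 0, 0, Pi.single i 1)
  · intro i
    simpa [inner] using h (0, 0, Pi.single i 1, 0)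

theorem exists_inner_eq_one {x : Oct} (h : x ≠ 0) : ∃ y, x.inner y = 1 := by
  by_contra! hy
  refine h (eq_zero_of_inner fun y => ?_)
  by_contra hne
  exact hy ((x.inner y)⁻¹ • y) (by rw [inner_smul_right, inv_mul_cancel₀ hne])

/-- If `x y = 0` with `x ≠ 0` then `y` is a multiple of the conjugate of `x`. -/
theorem exists_conj_mul_of_mul_eq_zero {x y : Oct} (hx : x ≠ 0) (h : x.mul y = 0) :
    ∃ w, (conj x).mul w = y := by
  -- With ⟨x, s⟩ = 1 and xy = 0, polarised alternativity x̄(sy) + s̄(xy) = ⟨x, s⟩y exhibits y as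
  -- x̄(sy).
  obtain ⟨s, hs⟩ := exists_inner_eq_one hx
  refine ⟨s.mul y, ?_⟩
  have := conj_mul_mul_add x s y
  rwa [h, mul_zero, add_zero, hs, one_smul] at this

theorem exists_mul_conj_of_mul_eq_zero {x y : Oct} (hy : y ≠ 0) (h : x.mul y = 0) :
    ∃ w : Oct, w.mul (conj y) = x := by
  obtain ⟨s, hs⟩ := exists_inner_eq_one hy
  refine ⟨x.mul s, ?_⟩
  have := mul_mul_conj_add y s x
  rwa [h, zero_mul, zero_add, hs, one_smul] at this

theorem norm_eq_zero_of_mul_eq_zero {x y : Oct} (hy : y ≠ 0) (h : x.mul y = 0) :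
    x.norm = 0 := by
  have h' := conj_mul_mul x y
  rw [h, mul_zero] at h'
  exact (smul_eq_zero.mp h'.symm).resolve_right hy

end Oct

/-! ### The grading of the Jordan algebra, the nilradicals and the transvections -/

/-- Polarisation of the composition law N(xz) = N(x)N(z) in x. -/
theorem Oct.inner_mul_mul_right (x y z : Oct) :
    (x.mul z).inner (y.mul z) = z.norm * x.inner y := by
  have h := Oct.norm_mul (x + y) z
  rw [Oct.add_mul, Oct.norm_add, Oct.norm_add, Oct.norm_mul, Oct.norm_mul] at h
  linear_combination h

theorem Oct.inner_mul_mul_left (x y z : Oct) :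
    (z.mul x).inner (z.mul y) = z.norm * x.inner y := by
  have h := Oct.norm_mul z (x + y)
  rw [Oct.mul_add, Oct.norm_add, Oct.norm_add, Oct.norm_mul, Oct.norm_mul] at h
  linear_combination h

namespace Jordan

theorem polar_add_middle (x y y' z : Jordan) :
    polar x (y + y') z = polar x y z + polar x y' z := by
  rw [polar_swap, polar_add, polar_swap y, polar_swap y']

theorem polar_add_right (x y z z' : Jordan) :
    polar x y (z + z') = polar x y z + polar x y z' := by
  rw [← polar_rotate, polar_add, polar_rotate z, polar_rotate z']

theorem zero_polar (y z : Jordan) : polar 0 y z = 0 := by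
  simpa using polar_smul 0 0 y z

theorem polar_zero_middle (x z : Jordan) : polar x 0 z = 0 := by
  rw [polar_swap, zero_polar]

theorem polar_zero_right (x y : Jordan) : polar x y 0 = 0 := by
  rw [← polar_rotate, zero_polar]

/-- The element `ξ` of the graded piece of degree `0`. -/
def deg0 (ξ : ℂ) : Jordan := (![ξ, 0, 0], 0)

/-- The element `(u, v)` of the graded piece of degree `1`. -/
def deg1 (u v : Oct) : Jordan := (0, ![0, u, v])

/-- The element `(η, d, ζ)` of the graded piece of degree `2`. -/
def deg2 (η : ℂ) (d : Oct) (ζ : ℂ) : Jordan := (![0, η, ζ], ![d, 0, 0])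

theorem ext_coords {x y : Jordan} (h₀ : x.1 0 = y.1 0) (h₁ : x.1 1 = y.1 1)
    (h₂ : x.1 2 = y.1 2) (k₀ : x.2 0 = y.2 0) (k₁ : x.2 1 = y.2 1) (k₂ : x.2 2 = y.2 2) :
    x = y := by
  refine Prod.ext (funext fun i => ?_) (funext fun i => ?_) <;> fin_cases i <;> assumption

theorem eq_deg_add (x : Jordan) :
    x = deg0 (x.1 0) + deg1 (x.2 1) (x.2 2) + deg2 (x.1 1) (x.2 0) (x.1 2) := by
  apply ext_coords <;> simp [deg0, deg1, deg2]

theorem deg1_add (u v u' v' : Oct) : deg1 u v + deg1 u' v' = deg1 (u + u') (v + v') := by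
  apply ext_coords <;> simp [deg1]

theorem smul_deg1 (c : ℂ) (u v : Oct) : c • deg1 u v = deg1 (c • u) (c • v) := by
  apply ext_coords <;> simp [deg1]

theorem deg1_injective {u v u' v' : Oct} (h : deg1 u v = deg1 u' v') : u = u' ∧ v = v' :=
  ⟨by simpa [deg1] using congrArg (fun x : Jordan => x.2 1) h,
    by simpa [deg1] using congrArg (fun x : Jordan => x.2 2) h⟩

theorem deg1_zero : deg1 0 0 = 0 := by
  apply ext_coords <;> simp [deg1]

theorem deg2_injective {η ζ η' ζ' : ℂ} {d d' : Oct} (h : deg2 η d ζ = deg2 η' d' ζ') :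
    η = η' ∧ d = d' ∧ ζ = ζ' :=
  ⟨by simpa [deg2] using congrArg (fun x : Jordan => x.1 1) h,
    by simpa [deg2] using congrArg (fun x : Jordan => x.2 0) h,
    by simpa [deg2] using congrArg (fun x : Jordan => x.1 2) h⟩

theorem deg2_zero : deg2 0 0 0 = 0 := by
  apply ext_coords <;> simp [deg2]

theorem smul_deg0 (c ξ : ℂ) : c • deg0 ξ = deg0 (c * ξ) := by
  apply ext_coords <;> simp [deg0]

theorem smul_deg2 (c η : ℂ) (d : Oct) (ζ : ℂ) :
    c • deg2 η d ζ = deg2 (c * η) (c • d) (c * ζ) := by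
  apply ext_coords <;> simp [deg2]

theorem deg2_add (η ζ η' ζ' : ℂ) (d d' : Oct) :
    deg2 η d ζ + deg2 η' d' ζ' = deg2 (η + η') (d + d') (ζ + ζ') := by
  apply ext_coords <;> simp [deg2]

end Jordan

namespace E6

open Jordan

theorem eq_zero_of_smul_eq_smul {V : Type*} [AddCommGroup V] [Module ℂ V] {a b : ℂ} {v : V}
    (hab : b ≠ a) (h : a • v = b • v) : v = 0 := by
  rw [← sub_eq_zero, ← sub_smul] at h
  exact (smul_eq_zero.mp h).resolve_left (sub_ne_zero.mpr hab.symm)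

theorem z_apply (x : Jordan) :
    z x = deg0 (8 / 3 * x.1 0) + deg1 ((2 / 3 : ℂ) • x.2 1) ((2 / 3 : ℂ) • x.2 2)
      + deg2 (-4 / 3 * x.1 1) ((-4 / 3 : ℂ) • x.2 0) (-4 / 3 * x.1 2) := by
  apply ext_coords <;> simp [z, deg0, deg1, deg2]

theorem z_deg0 (ξ : ℂ) : z (deg0 ξ) = (8 / 3 : ℂ) • deg0 ξ := by
  rw [z_apply]
  apply ext_coords <;> simp [deg0, deg1, deg2]

theorem z_deg1 (u v : Oct) : z (deg1 u v) = (2 / 3 : ℂ) • deg1 u v := by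
  rw [z_apply]
  apply ext_coords <;> simp [deg0, deg1, deg2]

theorem z_deg2 (η : ℂ) (d : Oct) (ζ : ℂ) : z (deg2 η d ζ) = (-4 / 3 : ℂ) • deg2 η d ζ := by
  rw [z_apply]
  apply ext_coords <;> simp [deg0, deg1, deg2]

theorem coords_of_z_apply_eq {x : Jordan} {μ : ℂ} (h : z x = μ • x) :
    (μ ≠ 8 / 3 → x.1 0 = 0) ∧ (μ ≠ 2 / 3 → x.2 1 = 0 ∧ x.2 2 = 0) ∧
      (μ ≠ -4 / 3 → x.1 1 = 0 ∧ x.2 0 = 0 ∧ x.1 2 = 0) := by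
  rw [z_apply] at h
  refine ⟨fun hμ => ?_, fun hμ => ⟨?_, ?_⟩, fun hμ => ⟨?_, ?_, ?_⟩⟩ <;>
    refine eq_zero_of_smul_eq_smul hμ ?_
  · simpa [deg0, deg1, deg2] using congrArg (fun x : Jordan => x.1 0) h
  · simpa [deg0, deg1, deg2] using congrArg (fun x : Jordan => x.2 1) h
  · simpa [deg0, deg1, deg2] using congrArg (fun x : Jordan => x.2 2) h
  · simpa [deg0, deg1, deg2] using congrArg (fun x : Jordan => x.1 1) h
  · simpa [deg0, deg1, deg2] using congrArg (fun x : Jordan => x.2 0) h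
  · simpa [deg0, deg1, deg2] using congrArg (fun x : Jordan => x.1 2) h

theorem exists_deg0 {x : Jordan} (h : z x = (8 / 3 : ℂ) • x) : ∃ ξ, x = deg0 ξ := by
  obtain ⟨-, h1, h2⟩ := coords_of_z_apply_eq h
  obtain ⟨h1, h1'⟩ := h1 (by norm_num)
  obtain ⟨h2, h2', h2''⟩ := h2 (by norm_num)
  refine ⟨x.1 0, ?_⟩
  apply ext_coords <;> simp [deg0, *]

theorem exists_deg1 {x : Jordan} (h : z x = (2 / 3 : ℂ) • x) : ∃ u v, x = deg1 u v := by
  obtain ⟨h0, -, h2⟩ := coords_of_z_apply_eq h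
  obtain h0 := h0 (by norm_num)
  obtain ⟨h2, h2', h2''⟩ := h2 (by norm_num)
  refine ⟨x.2 1, x.2 2, ?_⟩
  apply ext_coords <;> simp [deg1, *]

theorem exists_deg2 {x : Jordan} (h : z x = (-4 / 3 : ℂ) • x) : ∃ η d ζ, x = deg2 η d ζ := by
  obtain ⟨h0, h1, -⟩ := coords_of_z_apply_eq h
  obtain h0 := h0 (by norm_num)
  obtain ⟨h1, h1'⟩ := h1 (by norm_num)
  refine ⟨x.1 1, x.2 0, x.1 2, ?_⟩
  apply ext_coords <;> simp [deg2, *]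

theorem eq_zero_of_z_apply_eq {x : Jordan} {μ : ℂ} (h : z x = μ • x) (h0 : μ ≠ 8 / 3)
    (h1 : μ ≠ 2 / 3) (h2 : μ ≠ -4 / 3) : x = 0 := by
  obtain ⟨k0, k1, k2⟩ := coords_of_z_apply_eq h
  obtain k0 := k0 h0
  obtain ⟨k1, k1'⟩ := k1 h1
  obtain ⟨k2, k2', k2''⟩ := k2 h2
  apply ext_coords <;> simp [*]

theorem mem_E_zero {x : Jordan} : x ∈ E 0 ↔ ∃ ξ, x = deg0 ξ := by
  have h : (8 / 3 - 2 * ((0 : ℕ) : ℂ)) = 8 / 3 := by norm_num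
  rw [E, Module.End.mem_eigenspace_iff, h]
  refine ⟨exists_deg0, ?_⟩
  rintro ⟨ξ, rfl⟩
  exact z_deg0 ξ

theorem mem_E_one {x : Jordan} : x ∈ E 1 ↔ ∃ u v, x = deg1 u v := by
  have h : (8 / 3 - 2 * ((1 : ℕ) : ℂ)) = 2 / 3 := by norm_num
  rw [E, Module.End.mem_eigenspace_iff, h]
  refine ⟨exists_deg1, ?_⟩
  rintro ⟨u, v, rfl⟩
  exact z_deg1 u v

theorem mem_E_two {x : Jordan} : x ∈ E 2 ↔ ∃ η d ζ, x = deg2 η d ζ := by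
  have h : (8 / 3 - 2 * ((2 : ℕ) : ℂ)) = -4 / 3 := by norm_num
  rw [E, Module.End.mem_eigenspace_iff, h]
  refine ⟨exists_deg2, ?_⟩
  rintro ⟨η, d, ζ, rfl⟩
  exact z_deg2 η d ζ

/-- By polarisation, `g` is characterised by the derivative of the determinant. -/
theorem mem_g_of_polar_self {A : Module.End ℂ Jordan} (h : ∀ x, polar (A x) x x = 0) :
    A ∈ g := fun x y w => by
  have h1 := h (x + y + w)
  have h2 := h (x + y)
  have h3 := h (y + w)
  have h4 := h (x + w)
  have h5 := h x
  have h6 := h y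
  have h7 := h w
  have s : ∀ a b c, polar a b c = polar a c b := fun a b c => by
    rw [polar_rotate, polar_swap, ← polar_rotate, ← polar_rotate, polar_rotate]
  simp only [map_add, polar_add, polar_add_middle, polar_add_right] at h1 h2 h3 h4
  rw [polar_swap x, ← polar_rotate (A w)]
  -- Each term of the polarised identity arises twice, once for each order of the last two
  -- arguments; `s` identifies the two orders, whence the factor 1/2.
  linear_combination (1 / 2 : ℂ) * (h1 - h2 - h3 - h4 + h5 + h6 + h7 + s (A x) y w
    + s (A y) x w + s (A w) x y)

/-- The nilradical `𝔲₋`, parametrised by the graded piece of degree `1`. -/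
def lower : Jordan →ₗ[ℂ] Module.End ℂ Jordan :=
  LinearMap.mk₂ ℂ
    (fun x y => deg1 (y.1 0 • x.2 1) (y.1 0 • x.2 2)
      + deg2 ((x.2 2).inner (y.2 2)) (Oct.conj ((x.2 1).mul (y.2 2) + (y.2 1).mul (x.2 2)))
        ((x.2 1).inner (y.2 1)))
    (fun x x' y => by
      apply ext_coords <;>
        simp [deg1, deg2, Oct.inner_add_left, Oct.add_mul, Oct.mul_add] <;> abel)
    (fun c x y => by
      apply ext_coords <;>
        simp [deg1, deg2, Oct.inner_smul_left, Oct.smul_mul, Oct.mul_smul] <;>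
        first | ring1 | module)
    (fun x y y' => by
      apply ext_coords <;>
        simp [deg1, deg2, Oct.inner_add_right, Oct.add_mul, Oct.mul_add, add_smul] <;> abel)
    (fun c x y => by
      apply ext_coords <;>
        simp [deg1, deg2, Oct.inner_smul_right, Oct.smul_mul, Oct.mul_smul] <;>
        first | ring1 | module)

theorem lower_apply (x y : Jordan) : lower x y = deg1 (y.1 0 • x.2 1) (y.1 0 • x.2 2)
      + deg2 ((x.2 2).inner (y.2 2)) (Oct.conj ((x.2 1).mul (y.2 2) + (y.2 1).mul (x.2 2)))
        ((x.2 1).inner (y.2 1)) := rfl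

/-- The nilradical `𝔲₊`, parametrised by the graded piece of degree `1`. -/
def upper : Jordan →ₗ[ℂ] Module.End ℂ Jordan :=
  LinearMap.mk₂ ℂ
    (fun x y => deg0 ((x.2 1).inner (y.2 1) + (x.2 2).inner (y.2 2))
      + deg1 (y.1 2 • x.2 1 + Oct.conj ((x.2 2).mul (y.2 0)))
        (y.1 1 • x.2 2 + Oct.conj ((y.2 0).mul (x.2 1))))
    (fun x x' y => by
      apply ext_coords <;>
        simp [deg0, deg1, Oct.inner_add_left, Oct.add_mul, Oct.mul_add] <;> abel)
    (fun c x y => by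
      apply ext_coords <;>
        simp [deg0, deg1, Oct.inner_smul_left, Oct.smul_mul, Oct.mul_smul, mul_add] <;>
        first | ring1 | module)
    (fun x y y' => by
      apply ext_coords <;>
        simp [deg0, deg1, Oct.inner_add_right, Oct.add_mul, Oct.mul_add, add_smul] <;> abel)
    (fun c x y => by
      apply ext_coords <;>
        simp [deg0, deg1, Oct.inner_smul_right, Oct.smul_mul, Oct.mul_smul, mul_add] <;>
        first | ring1 | module)

theorem upper_apply (x y : Jordan) :
    upper x y = deg0 ((x.2 1).inner (y.2 1) + (x.2 2).inner (y.2 2))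
      + deg1 (y.1 2 • x.2 1 + Oct.conj ((x.2 2).mul (y.2 0)))
        (y.1 1 • x.2 2 + Oct.conj ((y.2 0).mul (x.2 1))) := rfl

/-- The derivative of the determinant. -/
theorem polar_self (x y : Jordan) : polar y x x =
    2 * (y.1 0 * (x.1 1 * x.1 2 - (x.2 0).norm) + y.1 1 * (x.1 2 * x.1 0 - (x.2 1).norm)
      + y.1 2 * (x.1 0 * x.1 1 - (x.2 2).norm)
      - x.1 0 * (x.2 0).inner (y.2 0) - x.1 1 * (x.2 1).inner (y.2 1)
      - x.1 2 * (x.2 2).inner (y.2 2)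
      + (y.2 0).inner (Oct.conj ((x.2 1).mul (x.2 2)))
      + (y.2 1).inner (Oct.conj ((x.2 2).mul (x.2 0)))
      + (y.2 2).inner (Oct.conj ((x.2 0).mul (x.2 1)))) := by
  rw [polar_eq, ← Oct.tri_eq_inner, ← Oct.tri_eq_inner, ← Oct.tri_eq_inner,
    ← Oct.tri_rotate _ (y.2 1), Oct.tri_rotate (y.2 2)]
  simp only [Fin.sum_univ_three, Oct.inner_self, Oct.inner_comm (y.2 _)]
  ring

/-- The terms in the derivative of the determinant cancel by cyclicity of the trilinear form (`h1`,
`h2`) and by the polarised composition laws. -/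
theorem lower_mem_g (x : Jordan) : lower x ∈ g := by
  refine mem_g_of_polar_self fun y => ?_
  have h1 : (y.2 0).inner (Oct.conj ((x.2 1).mul (y.2 2)))
      = (x.2 1).inner (Oct.conj ((y.2 2).mul (y.2 0))) := by
    rw [← Oct.tri_eq_inner, Oct.tri_rotate, Oct.tri_eq_inner]
  have h2 : (y.2 0).inner (Oct.conj ((y.2 1).mul (x.2 2)))
      = (x.2 2).inner (Oct.conj ((y.2 0).mul (y.2 1))) := by
    rw [← Oct.tri_eq_inner, ← Oct.tri_rotate, Oct.tri_eq_inner]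
  rw [polar_self, lower_apply]
  simp [deg1, deg2, Oct.inner_add_left, Oct.inner_add_right, Oct.inner_smul_left,
    Oct.inner_smul_right, Oct.inner_conj, Oct.inner_mul_mul_right, Oct.inner_mul_mul_left, h1,
    h2]
  rw [Oct.inner_comm (y.2 1), Oct.inner_comm (y.2 2)]
  ring

theorem upper_mem_g (x : Jordan) : upper x ∈ g := by
  refine mem_g_of_polar_self fun y => ?_
  have h1 : (y.2 1).inner (Oct.conj ((x.2 2).mul (y.2 0)))
      = (x.2 2).inner (Oct.conj ((y.2 0).mul (y.2 1))) := by
    rw [← Oct.tri_eq_inner, Oct.tri_rotate, Oct.tri_eq_inner]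
  have h2 : (y.2 2).inner (Oct.conj ((y.2 0).mul (x.2 1)))
      = (x.2 1).inner (Oct.conj ((y.2 2).mul (y.2 0))) := by
    rw [← Oct.tri_eq_inner, ← Oct.tri_rotate, Oct.tri_eq_inner]
  rw [polar_self, upper_apply]
  simp [deg1, deg0, Oct.inner_add_left, Oct.inner_add_right, Oct.inner_smul_left,
    Oct.inner_smul_right, Oct.inner_conj, Oct.inner_mul_mul_right, Oct.inner_mul_mul_left, h1, h2,
    Oct.inner_zero, Oct.zero_inner]
  rw [Oct.inner_comm (y.2 1), Oct.inner_comm (y.2 2)]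
  ring

theorem z_mul_lower (x : Jordan) : z * lower x - lower x * z = (-2 : ℂ) • lower x := by
  refine LinearMap.ext fun y => ?_
  change z (lower x y) - lower x (z y) = (-2 : ℂ) • lower x y
  rw [lower_apply x y, lower_apply, map_add, z_deg1, z_deg2, z_apply]
  apply ext_coords <;>
    simp [deg0, deg1, deg2, Oct.inner_smul_right, Oct.mul_smul, Oct.smul_mul] <;>
      first | ring1 | module

theorem z_mul_upper (x : Jordan) : z * upper x - upper x * z = (2 : ℂ) • upper x := by
  refine LinearMap.ext fun y => ?_
  change z (upper x y) - upper x (z y) = (2 : ℂ) • upper x y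
  rw [upper_apply x y, upper_apply, map_add, z_deg0, z_deg1, z_apply]
  apply ext_coords <;> simp [deg0, deg1, deg2, Oct.inner_smul_right, Oct.mul_smul, Oct.smul_mul,
    mul_add] <;> first | ring1 | module

theorem lower_mem_uMinus (x : Jordan) : lower x ∈ uMinus := ⟨lower_mem_g x, z_mul_lower x⟩

theorem lower_deg1_deg0 (u v : Oct) (ξ : ℂ) :
    lower (deg1 u v) (deg0 ξ) = ξ • deg1 u v := by
  rw [lower_apply]
  apply ext_coords <;> simp [deg0, deg1, deg2, Oct.inner_zero, Oct.mul_zero, Oct.zero_mul]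

theorem lower_deg1_deg1 (p q u v : Oct) : lower (deg1 p q) (deg1 u v) =
    deg2 (q.inner v) (Oct.conj (p.mul v + u.mul q)) (p.inner u) := by
  rw [lower_apply]
  apply ext_coords <;> simp [deg1, deg2]

theorem upper_deg1_deg1 (p q u v : Oct) : upper (deg1 p q) (deg1 u v) =
    deg0 (p.inner u + q.inner v) := by
  rw [upper_apply]
  apply ext_coords <;> simp [deg0, deg1, Oct.mul_zero, Oct.zero_mul]

theorem polar_deg0_deg2_deg2 (ξ η ζ η' ζ' : ℂ) (d d' : Oct) :
    polar (deg0 ξ) (deg2 η d ζ) (deg2 η' d' ζ') = ξ * (η * ζ' + η' * ζ - d.inner d') := by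
  rw [polar_eq]
  simp [deg0, deg2, Fin.sum_univ_three, Oct.tri, Oct.mul_zero, Oct.zero_mul, Oct.inner_zero,
    Oct.zero_inner, Oct.tr]
  ring

theorem polar_deg1_deg1_deg2 (η ζ : ℂ) (d u v u' v' : Oct) :
    polar (deg1 u v) (deg1 u' v') (deg2 η d ζ) =
      d.tri u v' + d.tri u' v - η * u.inner u' - ζ * v.inner v' := by
  rw [polar_eq]
  simp [deg1, deg2, Fin.sum_univ_three, Oct.tri, Oct.mul_zero, Oct.zero_mul, Oct.inner_zero,
    Oct.zero_inner, Oct.tr]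
  ring


/-! ### Elements of the nilradicals are determined by their action on the top -/

theorem uMinus_apply_deg0 {A : Module.End ℂ Jordan} (hA : A ∈ uMinus) (ξ : ℂ) :
    ∃ u v, A (deg0 ξ) = deg1 u v :=
  mem_E_one.mp (uMinus_mapsTo hA 0 (mem_E_zero.mpr ⟨ξ, rfl⟩))

theorem uMinus_apply_deg1 {A : Module.End ℂ Jordan} (hA : A ∈ uMinus) (u v : Oct) :
    ∃ η d ζ, A (deg1 u v) = deg2 η d ζ :=
  mem_E_two.mp (uMinus_mapsTo hA 1 (mem_E_one.mpr ⟨u, v, rfl⟩))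

theorem uMinus_apply_deg2 {A : Module.End ℂ Jordan} (hA : A ∈ uMinus) (η : ℂ) (d : Oct) (ζ : ℂ) :
    A (deg2 η d ζ) = 0 := by
  have h := uMinus_mapsTo hA 2 (mem_E_two.mpr ⟨η, d, ζ, rfl⟩)
  rw [E, Module.End.mem_eigenspace_iff] at h
  exact eq_zero_of_z_apply_eq h (by norm_num) (by norm_num) (by norm_num)

/-- Contracting the cubic form with the top vector leaves a nondegenerate quadratic form on 𝔼₂. -/
theorem deg2_eq_zero_of_polar {η ζ : ℂ} {d : Oct}
    (h : ∀ η' d' ζ', polar (deg0 1) (deg2 η d ζ) (deg2 η' d' ζ') = 0) : deg2 η d ζ = 0 := by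
  have h1 := h 0 0 1
  have h2 := h 1 0 0
  have h3 : d = 0 := Oct.eq_zero_of_inner fun y => by
    have := h 0 y 0
    rw [polar_deg0_deg2_deg2] at this
    linear_combination -this
  rw [polar_deg0_deg2_deg2, Oct.inner_zero] at h1 h2
  rw [show η = 0 by linear_combination h1, show ζ = 0 by linear_combination h2, h3, deg2_zero]

/-- Invariance of the cubic form on 𝔼₀ × 𝔼₁ × 𝔼₂ has only one surviving term, since A kills the top
vector and 𝔼₂. That term says A(𝔼₁) is orthogonal to 𝔼₂ for the nondegenerate form. -/
theorem uMinus_eq_zero {A : Module.End ℂ Jordan} (hA : A ∈ uMinus) (h : A (deg0 1) = 0) :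
    A = 0 := by
  have h1 : ∀ u v, A (deg1 u v) = 0 := fun u v => by
    obtain ⟨η, d, ζ, hd⟩ := uMinus_apply_deg1 hA u v
    rw [hd]
    refine deg2_eq_zero_of_polar fun η' d' ζ' => ?_
    have := hA.1 (deg0 1) (deg1 u v) (deg2 η' d' ζ')
    rwa [h, uMinus_apply_deg2 hA, zero_polar, polar_zero_right, hd, zero_add, add_zero] at this
  refine LinearMap.ext fun x => ?_
  rw [eq_deg_add x, map_add, map_add, h1, uMinus_apply_deg2 hA,
    show deg0 (x.1 0) = x.1 0 • deg0 1 by rw [smul_deg0, mul_one], map_smul, h]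
  simp

theorem eq_lower {A : Module.End ℂ Jordan} (hA : A ∈ uMinus) : A = lower (A (deg0 1)) := by
  obtain ⟨u, v, h⟩ := uMinus_apply_deg0 hA 1
  rw [← sub_eq_zero]
  refine uMinus_eq_zero (uMinus.sub_mem hA (lower_mem_uMinus _)) ?_
  rw [LinearMap.sub_apply, h, lower_deg1_deg0, one_smul, sub_self]

/-- The counterpart of `uMinus_eq_zero` for 𝔲₊, used to verify root space equations on 𝔼₁ alone. On
𝔼₂ the invariance of the cubic form becomes a skew-symmetry relation (`key`). -/
theorem upper_eq_zero {B : Module.End ℂ Jordan} (hB : B ∈ g) (hz : z * B - B * z = (2 : ℂ) • B)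
    (h : ∀ u v, B (deg1 u v) = 0) : B = 0 := by
  have hz' : ∀ x, z (B x) = B (z x) + (2 : ℂ) • B x := fun x => by
    have := LinearMap.congr_fun hz x
    change z (B x) - B (z x) = (2 : ℂ) • B x at this
    rw [← this]
    abel
  have h0 : B (deg0 1) = 0 := by
    have := hz' (deg0 1)
    rw [z_deg0, map_smul, ← add_smul] at this
    exact eq_zero_of_z_apply_eq this (by norm_num) (by norm_num) (by norm_num)
  have h2 : ∀ η d ζ, ∃ u v, B (deg2 η d ζ) = deg1 u v := fun η d ζ => by
    have := hz' (deg2 η d ζ)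
    rw [z_deg2, map_smul, ← add_smul] at this
    exact exists_deg1 (by rw [this]; norm_num)
  have key : ∀ u v η d ζ η' d' ζ', polar (deg1 u v) (B (deg2 η d ζ)) (deg2 η' d' ζ') +
      polar (deg1 u v) (B (deg2 η' d' ζ')) (deg2 η d ζ) = 0 := fun u v η d ζ η' d' ζ' => by
    have := hB (deg1 u v) (deg2 η d ζ) (deg2 η' d' ζ')
    rw [h, zero_polar, zero_add] at this
    rw [← this, ← polar_rotate (B (deg2 η' d' ζ')), polar_swap (deg1 u v) (B (deg2 η' d' ζ')),
      ← polar_rotate (deg2 η d ζ), polar_swap (deg2 η d ζ)]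
  have tri0 : ∀ x y, Oct.tri 0 x y = 0 := fun x y => by
    simp [Oct.tri, Oct.zero_mul, Oct.tr]
  obtain ⟨b, c, h3⟩ := h2 1 0 0
  obtain ⟨b', c', h4⟩ := h2 0 0 1
  -- Apply `key` first to the two diagonal vectors of 𝔼₂. Once B kills both, `key` against either of
  -- them isolates one octonionic coordinate of B on an arbitrary element of 𝔼₂.
  have hb : b = 0 := Oct.eq_zero_of_inner fun y => by
    have := key y 0 1 0 0 1 0 0
    simp only [h3, polar_deg1_deg1_deg2, tri0, Oct.zero_inner] at this
    rw [Oct.inner_comm]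
    linear_combination (-1 / 2 : ℂ) * this
  have hc' : c' = 0 := Oct.eq_zero_of_inner fun y => by
    have := key 0 y 0 0 1 0 0 1
    simp only [h4, polar_deg1_deg1_deg2, tri0, Oct.zero_inner] at this
    rw [Oct.inner_comm]
    linear_combination (-1 / 2 : ℂ) * this
  have hc : c = 0 := Oct.eq_zero_of_inner fun y => by
    have := key 0 y 1 0 0 0 0 1
    simp only [h3, h4, polar_deg1_deg1_deg2, tri0, Oct.zero_inner] at this
    rw [Oct.inner_comm]
    linear_combination - this
  have hb' : b' = 0 := Oct.eq_zero_of_inner fun y => by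
    have := key y 0 1 0 0 0 0 1
    simp only [h3, h4, polar_deg1_deg1_deg2, tri0, Oct.zero_inner] at this
    rw [Oct.inner_comm]
    linear_combination - this
  rw [hb, hc, deg1_zero] at h3
  rw [hb', hc', deg1_zero] at h4
  have h5 : ∀ η d ζ, B (deg2 η d ζ) = 0 := fun η d ζ => by
    obtain ⟨b, c, h5⟩ := h2 η d ζ
    have hb : b = 0 := Oct.eq_zero_of_inner fun y => by
      have := key y 0 η d ζ 1 0 0
      simp only [h3, h5, polar_deg1_deg1_deg2, tri0, Oct.zero_inner, polar_zero_middle] at this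
      rw [Oct.inner_comm]
      linear_combination - this
    have hc : c = 0 := Oct.eq_zero_of_inner fun y => by
      have := key 0 y η d ζ 0 0 1
      simp only [h4, h5, polar_deg1_deg1_deg2, tri0, Oct.zero_inner, polar_zero_middle] at this
      rw [Oct.inner_comm]
      linear_combination - this
    rw [h5, hb, hc, deg1_zero]
  refine LinearMap.ext fun x => ?_
  rw [eq_deg_add x, map_add, map_add, h, h5,
    show deg0 (x.1 0) = x.1 0 • deg0 1 by rw [smul_deg0, mul_one], map_smul, h0]
  simp

/-! ### The Cartan subalgebra and its weights -/

/-- The index set of the standard basis. -/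
abbrev Index : Type := Fin 3 ⊕ (Σ _ : Fin 3, Unit ⊕ Unit ⊕ Fin 3 ⊕ Fin 3)

/-- The weight of a standard basis vector. -/
def weight (k : Index) : Module.Dual ℂ t where
  toFun h := LinearMap.toMatrix Jordan.basis Jordan.basis (h : Module.End ℂ Jordan) k k
  map_add' := by simp
  map_smul' := by simp

theorem apply_basis (h : t) (k : Index) :
    (h : Module.End ℂ Jordan) (Jordan.basis k) = weight k h • Jordan.basis k := by
  apply Jordan.basis.repr.injective
  ext l
  rw [map_smul, Module.Basis.repr_self]
  by_cases hl : l = k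
  · subst hl
    simp [weight, LinearMap.toMatrix_apply]
  · have : LinearMap.toMatrix Jordan.basis Jordan.basis (h : Module.End ℂ Jordan) l k = 0 :=
      h.2.2 hl
    rw [LinearMap.toMatrix_apply] at this
    simp [this, Ne.symm hl]

theorem repr_apply (h : t) (x : Jordan) (k : Index) :
    Jordan.basis.repr ((h : Module.End ℂ Jordan) x) k = weight k h * Jordan.basis.repr x k := by
  have : (Jordan.basis.coord k).comp (h : Module.End ℂ Jordan) =
      weight k h • Jordan.basis.coord k := by
    refine Jordan.basis.ext fun l => ?_
    by_cases hl : k = l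
    · subst hl
      simp [apply_basis]
    · simp [apply_basis, Ne.symm hl]
  exact LinearMap.congr_fun this x

theorem commute_t (h h' : t) : (h : Module.End ℂ Jordan) * h' = (h' : Module.End ℂ Jordan) * h := by
  refine Jordan.basis.ext fun k => ?_
  change (h : Module.End ℂ Jordan) ((h' : Module.End ℂ Jordan) _) =
    (h' : Module.End ℂ Jordan) ((h : Module.End ℂ Jordan) _)
  rw [apply_basis, apply_basis, map_smul, map_smul, apply_basis, apply_basis, smul_comm]

theorem t_apply_deg1 (h : t) (u v : Oct) :
    ∃ u' v', (h : Module.End ℂ Jordan) (deg1 u v) = deg1 u' v' := by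
  refine exists_deg1 ?_
  have := LinearMap.congr_fun (commute_t ⟨z, z_mem_t⟩ h) (deg1 u v)
  change z ((h : Module.End ℂ Jordan) _) = (h : Module.End ℂ Jordan) (z _) at this
  rw [this, z_deg1, map_smul]

theorem basis_inl_zero : Jordan.basis (Sum.inl 0) = deg0 1 := by
  apply ext_coords <;> simp [Jordan.basis, deg0]

theorem basis_inr_one (j) : Jordan.basis (Sum.inr ⟨1, j⟩) = deg1 (Oct.basis j) 0 := by
  apply ext_coords <;> simp [Jordan.basis, deg1]

theorem basis_inr_two (j) : Jordan.basis (Sum.inr ⟨2, j⟩) = deg1 0 (Oct.basis j) := by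
  apply ext_coords <;> simp [Jordan.basis, deg1]

/-- The basis vector with index `k` belongs to the piece of degree one. -/
def IsDegOne : Index → Prop
  | Sum.inl _ => False
  | Sum.inr ⟨i, _⟩ => i ≠ 0

theorem IsDegOne.exists_eq {k : Index} (hk : IsDegOne k) :
    ∃ u v, Jordan.basis k = deg1 u v := by
  rcases k with i | ⟨i, j⟩
  · exact hk.elim
  · fin_cases i
    · exact (hk rfl).elim
    · exact ⟨_, _, basis_inr_one j⟩
    · exact ⟨_, _, basis_inr_two j⟩

theorem isDegOne_of_repr {u v : Oct} {k : Index} (h : Jordan.basis.repr (deg1 u v) k ≠ 0) :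
    IsDegOne k := by
  rcases k with i | ⟨i, j⟩
  · exact h (by simp [Jordan.basis, deg1])
  · rintro rfl
    exact h (by simp [Jordan.basis, deg1])

theorem weight_z_zero : weight (Sum.inl 0) ⟨z, z_mem_t⟩ = 8 / 3 := by
  simp [weight, LinearMap.toMatrix_apply, basis_inl_zero, z_deg0]
  simp [Jordan.basis, deg0]

theorem weight_z_of_isDegOne {k : Index} (hk : IsDegOne k) :
    weight k ⟨z, z_mem_t⟩ = 2 / 3 := by
  obtain ⟨u, v, h⟩ := hk.exists_eq
  rw [show weight k ⟨z, z_mem_t⟩ = Jordan.basis.repr (z (Jordan.basis k)) k by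
    simp [weight, LinearMap.toMatrix_apply], h, z_deg1, ← h]
  simp

theorem norm_octBasis (j) : (Oct.basis j).norm = 0 := by
  rcases j with j | j | j | j <;> simp [Oct.basis, Oct.norm]

/-- Standard basis octonions are null and the other octonionic coordinate is zero, so κ vanishes. -/
theorem lower_basis_basis {k : Index} (hk : IsDegOne k) :
    lower (Jordan.basis k) (Jordan.basis k) = 0 := by
  rcases k with i | ⟨i, j⟩
  · exact hk.elim
  · fin_cases i
    · exact (hk rfl).elim
    · simp only [Fin.mk_one]
      rw [basis_inr_one, lower_deg1_deg1, Oct.inner_self, Oct.inner_self, norm_octBasis,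
        Oct.norm_zero, Oct.mul_zero]
      simp [deg2_zero]
    · simp only [Fin.reduceFinMk]
      rw [basis_inr_two, lower_deg1_deg1, Oct.inner_self, Oct.inner_self, norm_octBasis,
        Oct.norm_zero, Oct.zero_mul]
      simp [deg2_zero]

/-- Every coordinate of the octonions is the product with some octonion. -/
theorem exists_inner_eq_repr (j) : ∃ r : Oct, ∀ x, r.inner x = Oct.basis.repr x j := by
  rcases j with j | j | j | j
  · exact ⟨(0, 1, 0, 0), fun x => by simp [Oct.inner, Oct.basis]⟩
  · exact ⟨(1, 0, 0, 0), fun x => by simp [Oct.inner, Oct.basis]⟩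
  · exact ⟨(0, 0, 0, -Pi.single j 1), fun x => by simp [Oct.inner, Oct.basis]⟩
  · exact ⟨(0, 0, -Pi.single j 1, 0), fun x => by simp [Oct.inner, Oct.basis]⟩

theorem exists_upper_eq_repr {k : Index} (hk : IsDegOne k) :
    ∃ x, ∀ u v, upper x (deg1 u v) = deg0 (Jordan.basis.repr (deg1 u v) k) := by
  rcases k with i | ⟨i, j⟩
  · exact hk.elim
  · obtain ⟨r, hr⟩ := exists_inner_eq_repr j
    fin_cases i
    · exact (hk rfl).elim
    · refine ⟨deg1 r 0, fun u v => ?_⟩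
      rw [upper_deg1_deg1, hr, Oct.zero_inner]
      simp [Jordan.basis, deg1]
    · refine ⟨deg1 0 r, fun u v => ?_⟩
      rw [upper_deg1_deg1, hr, Oct.zero_inner]
      simp [Jordan.basis, deg1]

/-- The root of `𝔲₊` attached to a basis vector of degree one. -/
def root (k : Index) : Module.Dual ℂ t := weight (Sum.inl 0) - weight k

theorem root_z {k : Index} (hk : IsDegOne k) : root k ⟨z, z_mem_t⟩ = 2 := by
  rw [root, LinearMap.sub_apply, weight_z_zero, weight_z_of_isDegOne hk]
  norm_num

/-- The Jacobi identity and [z, h] = 0: the adjoint action of the torus preserves the eigenspaces of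
ad z. -/
theorem ad_t_comm (h : t) (A : Module.End ℂ Jordan) (c : ℂ) (hA : z * A - A * z = c • A) :
    z * ((h : Module.End ℂ Jordan) * A - A * h) - ((h : Module.End ℂ Jordan) * A - A * h) * z =
      c • ((h : Module.End ℂ Jordan) * A - A * h) := by
  have hc : z * (h : Module.End ℂ Jordan) - h * z = 0 :=
    sub_eq_zero.mpr (commute_t ⟨z, z_mem_t⟩ h)
  calc _ = (h : Module.End ℂ Jordan) * (z * A - A * z) - (z * A - A * z) * h
        + ((z * (h : Module.End ℂ Jordan) - h * z) * A
          - A * (z * (h : Module.End ℂ Jordan) - h * z)) := by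
          simp only [mul_sub, sub_mul, mul_assoc]
          abel
    _ = _ := by
      rw [hc, hA, zero_mul, mul_zero, sub_zero, add_zero, mul_smul_comm, smul_mul_assoc, smul_sub]

/-- The difference of the two sides of the root equation lies in 𝔲₋, so it is enough to compare them
on the top vector, where weights are known. -/
theorem lower_mem_rootSpace {k : Index} (hk : IsDegOne k) :
    lower (Jordan.basis k) ∈ rootSpace (-root k) := by
  refine ⟨lower_mem_g _, fun h => ?_⟩
  rw [← sub_eq_zero]
  refine uMinus_eq_zero (uMinus.sub_mem ⟨commutator_mem_g h.2.1 (lower_mem_g _),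
    ad_t_comm h _ _ (z_mul_lower _)⟩ (uMinus.smul_mem _ (lower_mem_uMinus _))) ?_
  obtain ⟨u, v, huv⟩ := hk.exists_eq
  have h1 : lower (Jordan.basis k) (deg0 1) = Jordan.basis k := by
    rw [huv, lower_deg1_deg0, one_smul]
  have h2 := apply_basis h (Sum.inl 0)
  rw [basis_inl_zero] at h2
  simp only [LinearMap.sub_apply, Module.End.mul_apply, LinearMap.smul_apply, h1, h2, map_smul,
    apply_basis, root, LinearMap.neg_apply]
  module

/-- A root vector dual to `lower (Jordan.basis k)`: on 𝔼₁ it is a coordinate functional with values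
in the top line. Its root equation need only be tested on 𝔼₁ by `upper_eq_zero`. -/
theorem exists_upper_mem_rootSpace {k : Index} (hk : IsDegOne k) :
    ∃ B ∈ rootSpace (root k), ∀ u v, B (deg1 u v) = deg0 (Jordan.basis.repr (deg1 u v) k) := by
  obtain ⟨x, hx⟩ := exists_upper_eq_repr hk
  refine ⟨upper x, ⟨upper_mem_g _, fun h => ?_⟩, hx⟩
  rw [← sub_eq_zero]
  refine upper_eq_zero (g.sub_mem (commutator_mem_g h.2.1 (upper_mem_g _))
    (g.smul_mem _ (upper_mem_g _))) ?_ ?_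
  · have h1 := ad_t_comm h _ _ (z_mul_upper x)
    have h2 := z_mul_upper x
    rw [mul_sub, sub_mul, smul_sub, ← h1, mul_smul_comm, smul_mul_assoc, smul_comm (2 : ℂ), ← h2,
      smul_sub]
    abel
  · intro u v
    obtain ⟨u', v', h1⟩ := t_apply_deg1 h u v
    have h2 := apply_basis h (Sum.inl 0)
    rw [basis_inl_zero] at h2
    have h3 : ∀ ξ, deg0 ξ = ξ • deg0 1 := fun ξ => by rw [smul_deg0, mul_one]
    simp only [LinearMap.sub_apply, Module.End.mul_apply, LinearMap.smul_apply, h1, hx, root]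
    rw [← h1, repr_apply, h3, h3 (_ * _), map_smul, h2]
    module


/-! ### A generic element of the Cartan subalgebra -/

/-- The weights of a generic element of the Cartan subalgebra. -/
def genericWeight : Index → ℤ
  -- Invariance of the determinant requires, among other relations, that the diagonal weights sum to
  -- zero and that paired octonionic coordinates in slot i have weights adding up to minus the i-th
  -- diagonal weight. The values are chosen so that all 27 weights are distinct and the differences
  -- 76, -76 and 60 needed below each occur only once.
  | Sum.inl i => ![25, 10, -35] i
  | Sum.inr ⟨i, Sum.inl _⟩ => ![-21, 33, -12] i
  | Sum.inr ⟨i, Sum.inr (Sum.inl _)⟩ => ![-4, -43, 47] i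
  | Sum.inr ⟨i, Sum.inr (Sum.inr (Sum.inl j))⟩ => ![![15, 3, 12], ![-7, -19, -10], ![7, -5, 4]] i j
  | Sum.inr ⟨i, Sum.inr (Sum.inr (Sum.inr j))⟩ =>
    ![![-40, -28, -37], ![-3, 9, 0], ![28, 40, 31]] i j

/-- A generic element of the Cartan subalgebra. -/
def generic : Module.End ℂ Jordan :=
  LinearMap.prodMap
    (LinearMap.pi fun i => (genericWeight (Sum.inl i) : ℂ) • LinearMap.proj i)
    (LinearMap.pi fun i =>
      (LinearMap.prodMap ((genericWeight (Sum.inr ⟨i, Sum.inl ()⟩) : ℂ) • LinearMap.id)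
        (LinearMap.prodMap ((genericWeight (Sum.inr ⟨i, Sum.inr (Sum.inl ())⟩) : ℂ) • LinearMap.id)
          (LinearMap.prodMap
            (LinearMap.pi fun j =>
              (genericWeight (Sum.inr ⟨i, Sum.inr (Sum.inr (Sum.inl j))⟩) : ℂ) • LinearMap.proj j)
            (LinearMap.pi fun j =>
              (genericWeight (Sum.inr ⟨i, Sum.inr (Sum.inr (Sum.inr j))⟩) : ℂ) •
                LinearMap.proj j)))).comp (LinearMap.proj i))

theorem generic_basis (k : Index) :
    generic (Jordan.basis k) = (genericWeight k : ℂ) • Jordan.basis k := by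
  rcases k with i | ⟨i, j⟩
  · fin_cases i <;> apply ext_coords <;> simp [generic, Jordan.basis]
  · rcases j with j | j | j | j
    · fin_cases i <;> apply ext_coords <;> simp [generic, Jordan.basis, Oct.basis]
    · fin_cases i <;> apply ext_coords <;> simp [generic, Jordan.basis, Oct.basis]
    · fin_cases i <;> fin_cases j <;> apply ext_coords <;>
        simp [generic, Jordan.basis, Oct.basis] <;> (ext l; fin_cases l <;> simp)
    · fin_cases i <;> fin_cases j <;> apply ext_coords <;>
        simp [generic, Jordan.basis, Oct.basis] <;> (ext l; fin_cases l <;> simp)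

theorem generic_mem_g : generic ∈ g := by
  refine mem_g_of_polar_self fun x => ?_
  rw [polar_self]
  simp [generic, genericWeight, Oct.inner, Oct.conj_apply, Oct.norm, Oct.mul, cross_apply,
    dotProduct, Fin.sum_univ_three, Matrix.vecHead, Matrix.vecTail]
  ring

theorem generic_mem_t : generic ∈ t := by
  refine ⟨generic_mem_g, fun i j hij => ?_⟩
  change LinearMap.toMatrix Jordan.basis Jordan.basis generic i j = 0
  rw [LinearMap.toMatrix_apply, generic_basis, map_smul, Module.Basis.repr_self]
  simp [Ne.symm hij]

theorem weight_generic (k : Index) : weight k ⟨generic, generic_mem_t⟩ = genericWeight k := by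
  simp [weight, LinearMap.toMatrix_apply, generic_basis]

theorem genericWeight_injective : Function.Injective genericWeight := by
  decide +kernel

/-- An eigenvector of the generic element is a multiple of a standard basis vector. -/
theorem eq_smul_basis_of_generic {x : Jordan} {μ : ℂ} (hx : x ≠ 0) (h : generic x = μ • x) :
    ∃ k, ∃ c : ℂ, x = c • Jordan.basis k := by
  have hr : ∀ k, (genericWeight k : ℂ) * Jordan.basis.repr x k = μ * Jordan.basis.repr x k :=
    fun k => by
      rw [← weight_generic, ← repr_apply]
      simp [h]
  obtain ⟨k, hk⟩ : ∃ k, Jordan.basis.repr x k ≠ 0 := by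
    by_contra! hk
    exact hx (Jordan.basis.repr.injective (by ext k; simp [hk]))
  refine ⟨k, Jordan.basis.repr x k, Jordan.basis.repr.injective ?_⟩
  ext l
  rw [map_smul, Module.Basis.repr_self]
  by_cases hl : k = l
  · subst hl
    simp
  · have : Jordan.basis.repr x l = 0 := by
      by_contra hne
      have h1 := mul_right_cancel₀ hk (hr k)
      have h2 := mul_right_cancel₀ hne (hr l)
      exact hl (genericWeight_injective (by exact_mod_cast h1.trans h2.symm))
    simp [this, hl]

/-- A linear form which takes on the generic element a value that is the difference of two
weights only once is not a root, if the corresponding weight vectors can be separated by the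
determinant. -/
theorem not_isRoot_of_genericWeight {α : Module.Dual ℂ t} {i j : Index} (m : ℤ)
    (hα : α ⟨generic, generic_mem_t⟩ = m)
    (hm : ∀ p : Index × Index, genericWeight p.2 - genericWeight p.1 = m → p = (i, j))
    {k l : Index} (hk : k ≠ i) (hl : l ≠ i)
    (hp : polar (Jordan.basis j) (Jordan.basis k) (Jordan.basis l) ≠ 0) : ¬ IsRoot α := by
  rintro ⟨-, X, hX, hne⟩
  have h := hX.2 ⟨generic, generic_mem_t⟩
  rw [hα] at h
  -- A nonzero matrix entry from a to b forces the weight difference to be m, so X can have only the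
  -- entry from i to j.
  have h1 : ∀ a b, Jordan.basis.repr (X (Jordan.basis a)) b ≠ 0 → a = i ∧ b = j := by
    intro a b hab
    refine Prod.mk_inj.mp (hm (a, b) ?_)
    have h2 := congrArg (fun x => Jordan.basis.repr x b) (LinearMap.congr_fun h (Jordan.basis a))
    have h3 := repr_apply ⟨generic, generic_mem_t⟩ (X (Jordan.basis a)) b
    simp only [LinearMap.sub_apply, Module.End.mul_apply, LinearMap.smul_apply, map_sub, map_smul,
      generic_basis, Finsupp.sub_apply, Finsupp.smul_apply, h3, weight_generic, smul_eq_mul] at h2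
    rw [← sub_mul] at h2
    exact_mod_cast mul_right_cancel₀ hab h2
  have h2 : ∀ a, a ≠ i → X (Jordan.basis a) = 0 := fun a ha =>
    Jordan.basis.repr.injective (by
      ext b
      by_contra hb
      exact ha (h1 a b (by simpa using hb)).1)
  have h3 : X (Jordan.basis i) = Jordan.basis.repr (X (Jordan.basis i)) j • Jordan.basis j :=
    Jordan.basis.repr.injective (by
      ext b
      by_cases hb : j = b
      · subst hb
        simp
      · have : Jordan.basis.repr (X (Jordan.basis i)) b = 0 := by
          by_contra hne
          exact hb (h1 i b hne).2.symm
        simp [this, hb])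
  -- Since X kills the vectors k and l, invariance of the cubic form retains one term, which forces
  -- the last entry to vanish.
  have h4 := hX.1 (Jordan.basis i) (Jordan.basis k) (Jordan.basis l)
  rw [h2 k hk, h2 l hl, polar_zero_middle, polar_zero_right, h3, polar_smul, add_zero,
    add_zero] at h4
  rw [(mul_eq_zero.mp h4).resolve_right hp, zero_smul] at h3
  refine hne (Jordan.basis.ext fun a => ?_)
  by_cases ha : a = i
  · rw [ha, h3, LinearMap.zero_apply]
  · rw [h2 a ha, LinearMap.zero_apply]

/-! ### Root vectors of `𝔲₋` -/

theorem mem_uMinus_of_mem_rootSpace {α : Module.Dual ℂ t} (hα : α ⟨z, z_mem_t⟩ = 2)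
    {A : Module.End ℂ Jordan} (hA : A ∈ rootSpace (-α)) : A ∈ uMinus := by
  refine ⟨hA.1, ?_⟩
  have := hA.2 ⟨z, z_mem_t⟩
  rwa [LinearMap.neg_apply, hα] at this

theorem rootSpace_apply_deg0 {α : Module.Dual ℂ t} {A : Module.End ℂ Jordan}
    (hA : A ∈ rootSpace (-α)) (h : t) : (h : Module.End ℂ Jordan) (A (deg0 1)) =
      (weight (Sum.inl 0) h - α h) • A (deg0 1) := by
  have h1 := LinearMap.congr_fun (hA.2 h) (deg0 1)
  have h2 := apply_basis h (Sum.inl 0)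
  rw [basis_inl_zero] at h2
  simp only [LinearMap.sub_apply, Module.End.mul_apply, h2, map_smul, LinearMap.smul_apply,
    LinearMap.neg_apply] at h1
  rw [sub_eq_iff_eq_add.mp h1]
  module

/-- The root vectors of `𝔲₋` are the multiples of the standard ones. -/
theorem exists_eq_lower_basis {α : Module.Dual ℂ t} (hα : α ⟨z, z_mem_t⟩ = 2)
    {A : Module.End ℂ Jordan} (hA : A ∈ rootSpace (-α)) (hne : A ≠ 0) :
    ∃ k, IsDegOne k ∧ α = root k ∧ ∃ c : ℂ, c ≠ 0 ∧ A = c • lower (Jordan.basis k) := by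
  have hu := mem_uMinus_of_mem_rootSpace hα hA
  have h0 : A (deg0 1) ≠ 0 := fun h => hne (uMinus_eq_zero hu h)
  -- The image of the top vector is a weight vector; the distinct weights of `generic` make it a
  -- multiple of one basis vector.
  obtain ⟨k, c, hk⟩ :=
    eq_smul_basis_of_generic h0 (rootSpace_apply_deg0 hA ⟨generic, generic_mem_t⟩)
  have hc : c ≠ 0 := by
    rintro rfl
    exact h0 (by rw [hk, zero_smul])
  obtain ⟨u, v, huv⟩ := uMinus_apply_deg0 hu 1
  refine ⟨k, isDegOne_of_repr (u := u) (v := v) ?_, ?_, c, hc, ?_⟩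
  · rw [← huv, hk]
    simpa using hc
  · ext h
    have h1 := rootSpace_apply_deg0 hA h
    rw [hk, map_smul, apply_basis, smul_comm, ← sub_eq_zero] at h1
    rw [← sub_smul, smul_eq_zero, ← hk] at h1
    have h2 := h1.resolve_right h0
    rw [root, LinearMap.sub_apply]
    linear_combination h2
  · rw [eq_lower hu, hk, map_smul]

theorem isRoot_root {k : Index} (hk : IsDegOne k) : IsRoot (root k) := by
  refine ⟨fun h => ?_, ?_⟩
  · have := root_z hk
    rw [h] at this
    simp at this
  · obtain ⟨B, hB, h⟩ := exists_upper_mem_rootSpace hk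
    refine ⟨B, hB, ?_⟩
    rintro rfl
    obtain ⟨u, v, huv⟩ := hk.exists_eq
    have := congrArg (fun x : Jordan => x.1 0) (h u v)
    rw [← huv] at this
    simp [deg0] at this

/-- Root vectors for strongly orthogonal roots of `𝔲₋` have nonzero product. -/
theorem lower_basis_mul_ne_zero {i j : Index} (hi : IsDegOne i) (hj : IsDegOne j)
    (hij : root j - root i ≠ 0) (h : ¬ IsRoot (root j - root i)) :
    lower (Jordan.basis i) (Jordan.basis j) ≠ 0 := by
  obtain ⟨B, hB, hBr⟩ := exists_upper_mem_rootSpace hj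
  set A := lower (Jordan.basis i) with hA
  have hAr : A ∈ rootSpace (-root i) := lower_mem_rootSpace hi
  obtain ⟨u, v, huv⟩ := hi.exists_eq
  obtain ⟨u', v', huv'⟩ := hj.exists_eq
  -- A nonzero commutator would be a root vector for `root j - root i`.
  have h0 : A * B - B * A = 0 := by
    by_contra hne
    refine h ⟨hij, _, ⟨commutator_mem_g hAr.1 hB.1, fun x => ?_⟩, hne⟩
    have h1 := hAr.2 x
    have h2 := hB.2 x
    rw [LinearMap.neg_apply] at h1
    calc _ = ((x : Module.End ℂ Jordan) * A - A * x) * B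
            - B * ((x : Module.End ℂ Jordan) * A - A * x)
          + (A * ((x : Module.End ℂ Jordan) * B - B * x)
            - ((x : Module.End ℂ Jordan) * B - B * x) * A) := by
          simp only [mul_sub, sub_mul, mul_assoc]
          abel
      _ = _ := by
        rw [h1, h2]
        simp only [smul_mul_assoc, mul_smul_comm, LinearMap.sub_apply]
        module
  intro hzero
  -- B sends the j-th basis vector to the top vector and A sends that to the i-th one. If A killed
  -- the j-th basis vector, commutation would make the i-th one zero.
  have h1 := LinearMap.congr_fun h0 (Jordan.basis j)
  rw [LinearMap.sub_apply, Module.End.mul_apply, Module.End.mul_apply, hzero, map_zero, huv', hBr,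
    ← huv', Module.Basis.repr_self, Finsupp.single_eq_same, hA, huv, lower_deg1_deg0, one_smul,
    ← huv, sub_zero] at h1
  exact Jordan.basis.ne_zero i h1


/-! ### Elements of the group `K` -/

/-- The transvection of the Jordan algebra with parameter `w`. -/
def transvectionFun (w : Oct) : Module.End ℂ Jordan where
  -- Formally X ↦ (1 + wE₂₁) X (1 + wE₂₁)*, with rows and columns numbered from 0: w times row 1 is
  -- added to row 2, and likewise for columns.
  toFun x := deg0 (x.1 0) + deg1 (x.2 1 + w.mul (Oct.conj (x.2 2))) (x.2 2)
    + deg2 (x.1 1) (x.2 0 + x.1 1 • Oct.conj w) (x.1 2 + (w.mul (x.2 0)).tr + x.1 1 * w.norm)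
  map_add' x y := by
    apply ext_coords <;> simp [deg0, deg1, deg2, Oct.mul_add, Oct.tr_add] <;>
      first | ring1 | module
  map_smul' c x := by
    apply ext_coords <;> simp [deg0, deg1, deg2, Oct.mul_smul, Oct.tr_smul] <;>
      first | ring1 | module

theorem transvectionFun_apply (w : Oct) (x : Jordan) : transvectionFun w x =
    deg0 (x.1 0) + deg1 (x.2 1 + w.mul (Oct.conj (x.2 2))) (x.2 2)
    + deg2 (x.1 1) (x.2 0 + x.1 1 • Oct.conj w) (x.1 2 + (w.mul (x.2 0)).tr + x.1 1 * w.norm) :=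
  rfl

theorem transvectionFun_neg (w : Oct) (x : Jordan) :
    transvectionFun (-w) (transvectionFun w x) = x := by
  have hneg : ∀ x, (-w).mul x = -(w.mul x) := fun x => by
    simpa using Oct.smul_mul (-1) w x
  have h1 : (w.mul (Oct.conj w)).tr = 2 * w.norm := by
    rw [Oct.tr_mul_conj, Oct.inner_self]
  have h2 : (-w).norm = w.norm := by
    simpa using Oct.norm_smul (-1) w
  have h3 : ∀ x, Oct.tr (-x) = -x.tr := fun x => by
    simpa using Oct.tr_smul (-1) x
  rw [transvectionFun_apply, transvectionFun_apply]
  apply ext_coords <;> simp [deg0, deg1, deg2, hneg, h2, h3, Oct.mul_add, Oct.mul_smul, Oct.tr_add,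
    Oct.tr_smul, h1]
  ring

theorem det_transvectionFun (w : Oct) (x : Jordan) : det (transvectionFun w x) = det x := by
  have h1 : (((x.2 0).mul (w.mul (Oct.conj (x.2 2)))).mul (x.2 2)).tr =
      (x.2 2).norm * (w.mul (x.2 0)).tr := by
    have := Oct.tri_eq (x.2 0) (w.mul (Oct.conj (x.2 2))) (x.2 2)
    rw [Oct.mul_conj_mul', Oct.mul_smul, Oct.tr_smul, Oct.tr_mul_comm] at this
    exact this
  have h2 : (((Oct.conj w).mul (w.mul (Oct.conj (x.2 2)))).mul (x.2 2)).tr =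
      2 * w.norm * (x.2 2).norm := by
    rw [Oct.conj_mul_mul, Oct.smul_mul, Oct.tr_smul, Oct.tr_mul_comm, Oct.tr_mul_conj,
      Oct.inner_self]
    ring
  have h3 : (x.2 1).inner (w.mul (Oct.conj (x.2 2))) =
      (((Oct.conj w).mul (x.2 1)).mul (x.2 2)).tr := by
    have := Oct.tri_rotate (Oct.conj w) (x.2 1) (x.2 2)
    rw [Oct.tri_eq (x.2 1), ← Oct.conj_conj ((x.2 2).mul _), Oct.tr_mul_conj, Oct.conj_mul,
      Oct.conj_conj] at this
    exact this.symm
  have h4 : (x.2 0).inner (Oct.conj w) = (w.mul (x.2 0)).tr := by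
    rw [← Oct.tr_mul_conj, Oct.conj_conj, Oct.tr_mul_comm]
  rw [transvectionFun_apply]
  simp [det, deg0, deg1, deg2, Fin.sum_univ_three, Oct.norm_add, Oct.norm_smul, Oct.norm_mul,
    Oct.norm_conj, Oct.inner_smul_right, Oct.add_mul, Oct.mul_add, Oct.smul_mul, Oct.tr_add,
    Oct.tr_smul, h1, h2, h3, h4]
  ring

/-- The transvection as a linear automorphism. -/
def transvection (w : Oct) : Jordan ≃ₗ[ℂ] Jordan :=
  { transvectionFun w with
    invFun := transvectionFun (-w)
    left_inv := transvectionFun_neg w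
    right_inv := fun x => by simpa using transvectionFun_neg (-w) x }

theorem transvection_mem_K (w : Oct) : transvection w ∈ K := by
  refine ⟨det_transvectionFun w, fun x => ?_⟩
  change transvectionFun w (z x) = z (transvectionFun w x)
  rw [transvectionFun_apply, transvectionFun_apply, map_add, map_add, z_deg0, z_deg1, z_deg2,
    z_apply]
  apply ext_coords <;> simp [deg0, deg1, deg2, Oct.mul_smul, Oct.tr_smul] <;>
    first | ring1 | module

/-- The automorphism of the Jordan algebra that transposes two rows and two columns. -/
def swap : Jordan ≃ₗ[ℂ] Jordan :=
  LinearEquiv.ofInvolutive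
    { toFun := fun x => deg0 (x.1 0) + deg1 (Oct.conj (x.2 2)) (Oct.conj (x.2 1))
        + deg2 (x.1 2) (Oct.conj (x.2 0)) (x.1 1)
      map_add' := fun x y => by
        apply ext_coords <;> simp [deg0, deg1, deg2]
      map_smul' := fun c x => by
        apply ext_coords <;> simp [deg0, deg1, deg2] }
    (fun x => by
      apply ext_coords <;> simp [deg0, deg1, deg2, Oct.conj_conj])

theorem swap_apply (x : Jordan) : swap x =
    deg0 (x.1 0) + deg1 (Oct.conj (x.2 2)) (Oct.conj (x.2 1))
        + deg2 (x.1 2) (Oct.conj (x.2 0)) (x.1 1) := rfl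

theorem swap_mem_K : swap ∈ K := by
  refine ⟨fun x => ?_, fun x => ?_⟩
  · have h : (((Oct.conj (x.2 0)).mul (Oct.conj (x.2 2))).mul (Oct.conj (x.2 1))).tr =
        (((x.2 0).mul (x.2 1)).mul (x.2 2)).tr := by
      rw [← Oct.conj_mul, ← Oct.conj_mul, Oct.tr_conj, ← Oct.tri_eq, ← Oct.tri_rotate]
      rfl
    rw [swap_apply]
    simp [det, deg0, deg1, deg2, Fin.sum_univ_three, Oct.norm_conj, h]
    ring
  · rw [swap_apply, swap_apply, map_add, map_add, z_deg0, z_deg1, z_deg2, z_apply]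
    apply ext_coords <;> simp [deg0, deg1, deg2]

theorem polar_map {k : Jordan ≃ₗ[ℂ] Jordan} (hk : k ∈ G) (x y w : Jordan) :
    polar (k x) (k y) (k w) = polar x y w := by
  have hk' : ∀ x, det (k x) = det x := hk
  simp only [polar, ← map_add, hk']

theorem conj_mem_uMinus {k : Jordan ≃ₗ[ℂ] Jordan} (hk : k ∈ K) {A : Module.End ℂ Jordan}
    (hA : A ∈ uMinus) : k.conj A ∈ uMinus := by
  refine ⟨fun x y w => ?_, LinearMap.ext fun x => ?_⟩
  · have := hA.1 (k.symm x) (k.symm y) (k.symm w)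
    rw [← polar_map hk.1, ← polar_map hk.1 _ (A _), ← polar_map hk.1 _ _ (A _)] at this
    simpa [LinearEquiv.conj_apply] using this
  · have h1 := LinearMap.congr_fun hA.2 (k.symm x)
    have h2 : k.symm (z x) = z (k.symm x) := ((K.inv_mem hk).2 x)
    change z (k (A (k.symm x))) - k (A (k.symm (z x))) = (-2 : ℂ) • k (A (k.symm x))
    rw [h2, ← hk.2, ← map_sub, ← map_smul]
    exact congrArg k h1

theorem K_apply_deg0 {k : Jordan ≃ₗ[ℂ] Jordan} (hk : k ∈ K) (ξ : ℂ) :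
    ∃ ξ', k (deg0 ξ) = deg0 ξ' :=
  exists_deg0 (by rw [← hk.2, z_deg0, map_smul])

theorem K_apply_deg1 {k : Jordan ≃ₗ[ℂ] Jordan} (hk : k ∈ K) (u v : Oct) :
    ∃ u' v', k (deg1 u v) = deg1 u' v' :=
  exists_deg1 (by rw [← hk.2, z_deg1, map_smul])

/-- `x` and `y` are conjugate under the elements of `K` which fix the top vector. -/
def Equivalent (x y : Oct × Oct) : Prop :=
  ∃ k ∈ K, k (deg0 1) = deg0 1 ∧ k (deg1 x.1 x.2) = deg1 y.1 y.2

theorem Equivalent.symm {x y : Oct × Oct} (h : Equivalent x y) : Equivalent y x := by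
  obtain ⟨k, hk, h0, h1⟩ := h
  refine ⟨k⁻¹, K.inv_mem hk, ?_, ?_⟩
  · change k.symm _ = _
    rw [LinearEquiv.symm_apply_eq, h0]
  · change k.symm _ = _
    rw [LinearEquiv.symm_apply_eq, h1]

theorem Equivalent.trans {x y w : Oct × Oct} (h : Equivalent x y) (h' : Equivalent y w) :
    Equivalent x w := by
  obtain ⟨k, hk, h0, h1⟩ := h
  obtain ⟨l, hl, h2, h3⟩ := h'
  refine ⟨l * k, K.mul_mem hl hk, ?_, ?_⟩
  · change l (k _) = _
    rw [h0, h2]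
  · change l (k _) = _
    rw [h1, h3]

theorem equivalent_swap (u v : Oct) : Equivalent (u, v) (Oct.conj v, Oct.conj u) := by
  refine ⟨swap, swap_mem_K, ?_, ?_⟩ <;> rw [swap_apply] <;>
    apply ext_coords <;> simp [deg0, deg1, deg2]

theorem equivalent_add_left (u v w : Oct) : Equivalent (u, v) (u + w.mul (Oct.conj v), v) := by
  refine ⟨transvection w, transvection_mem_K w, ?_, ?_⟩
  · change transvectionFun w _ = _
    rw [transvectionFun_apply]
    apply ext_coords <;> simp [deg0, deg1, deg2, Oct.mul_zero, Oct.tr]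
  · change transvectionFun w _ = _
    rw [transvectionFun_apply]
    apply ext_coords <;> simp [deg0, deg1, deg2, Oct.mul_zero, Oct.tr]

/-- The transvection of `equivalent_add_left`, conjugated by `swap`. -/
theorem equivalent_add_right (u v w : Oct) : Equivalent (u, v) (u, v + (Oct.conj u).mul w) := by
  have h := ((equivalent_swap u v).trans (equivalent_add_left _ _ (Oct.conj w))).trans
    (equivalent_swap _ _)
  rwa [Oct.conj_conj, map_add, Oct.conj_conj, Oct.conj_mul, Oct.conj_conj] at h

/-! ### The orbits of `K` on the half-spinors -/

theorem equivalent_unit_of_norm_right {u v : Oct} (h : v.norm ≠ 0) :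
    Equivalent (u, v) (Oct.unit, 0) := by
  -- The parameter w solves w v̄ = 1 - u, which is possible because v is invertible. With 1 in the
  -- first place, the second entry can be cleared.
  have h1 := equivalent_add_left u v (v.norm⁻¹ • (Oct.unit - u).mul v)
  rw [Oct.smul_mul, Oct.mul_mul_conj, smul_smul, inv_mul_cancel₀ h, one_smul,
    add_sub_cancel] at h1
  have h2 := equivalent_add_right Oct.unit v (-v)
  have h3 : Oct.conj Oct.unit = Oct.unit := by
    simp [Oct.conj_apply, Oct.unit]
  rw [h3, Oct.unit_mul, add_neg_cancel] at h2
  exact h1.trans h2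

theorem equivalent_unit_of_norm_left {u v : Oct} (h : u.norm ≠ 0) :
    Equivalent (u, v) (Oct.unit, 0) :=
  (equivalent_swap u v).trans (equivalent_unit_of_norm_right (by rwa [Oct.norm_conj]))

theorem equivalent_unit {u v : Oct} (h : u.norm ≠ 0 ∨ v.norm ≠ 0 ∨ u.mul v ≠ 0) :
    Equivalent (u, v) (Oct.unit, 0) := by
  by_cases hu : u.norm = 0
  · by_cases hv : v.norm = 0
    · obtain ⟨w, hw⟩ := Oct.exists_inner_eq_one ((h.resolve_left (not_not.mpr hu)).resolve_left
        (not_not.mpr hv))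
      refine (equivalent_add_left u v w).trans (equivalent_unit_of_norm_left ?_)
      -- When u and v are null, N(u + w v̄) = ⟨u, w v̄⟩ = ⟨uv, w⟩, so uv ≠ 0 allows the first entry
      -- to be made invertible.
      have h1 : u.inner (w.mul (Oct.conj v)) = 1 := by
        rw [← Oct.tr_mul_conj, Oct.conj_mul, Oct.conj_conj, ← Oct.tri_eq, Oct.tri,
          Oct.tr_mul_conj, hw]
      rw [Oct.norm_add, Oct.norm_mul, Oct.norm_conj, hu, hv, h1]
      simp
    · exact equivalent_unit_of_norm_right hv
  · exact equivalent_unit_of_norm_left hu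

/-- A transvection creates the conjugate of xc in the second slot. Since c(c̄x̄) = N(c)x̄ = 0, c has
the form w(xc), and a second transvection clears the first slot. The swap then brings xc back to it.
-/
theorem equivalent_mul_left {c x : Oct} (hc : c.norm = 0) (hx : x.mul c ≠ 0) :
    Equivalent (c, 0) (x.mul c, 0) := by
  have h1 := equivalent_add_right c 0 (Oct.conj x)
  rw [zero_add, ← Oct.conj_mul] at h1
  have h2 : c.mul (Oct.conj (x.mul c)) = 0 := by
    rw [Oct.conj_mul, Oct.mul_conj_mul, hc, zero_smul]
  have h3 : Oct.conj (x.mul c) ≠ 0 := fun h => hx (Oct.conj_injective (by rw [h, map_zero]))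
  obtain ⟨w, hw⟩ := Oct.exists_mul_conj_of_mul_eq_zero h3 h2
  have h4 := equivalent_add_left c (Oct.conj (x.mul c)) (-w)
  have h5 := equivalent_swap 0 (Oct.conj (x.mul c))
  have hneg : ∀ y, (-w).mul y = -(w.mul y) := fun y => by
    simpa using Oct.smul_mul (-1) w y
  rw [hneg, hw, add_neg_cancel] at h4
  rw [map_zero, Oct.conj_conj] at h5
  exact (h1.trans h4).trans h5

/-- A primitive idempotent of the octonions. -/
def octIdem : Oct := (0, 1, 0, 0)

theorem exists_dotProduct_eq_one {v : Fin 3 → ℂ} (hv : v ≠ 0) : ∃ w : Fin 3 → ℂ, w ⬝ᵥ v = 1 := by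
  obtain ⟨i, hi⟩ := Function.ne_iff.mp hv
  exact ⟨Pi.single i (v i)⁻¹, by simpa using inv_mul_cancel₀ hi⟩

theorem exists_crossProduct_ne_zero {v : Fin 3 → ℂ} (hv : v ≠ 0) :
    ∃ w : Fin 3 → ℂ, crossProduct v w ≠ 0 := by
  by_contra! h
  refine hv (funext fun i => ?_)
  have h1 := h (Pi.single 0 1)
  have h2 := h (Pi.single 1 1)
  rw [cross_apply] at h1 h2
  fin_cases i
  · simpa using congrFun h2 2
  · simpa using congrFun h1 2
  · simpa using congrFun h1 1

theorem equivalent_idem_of_vec {v : Fin 3 → ℂ} (hv : v ≠ 0) :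
    Equivalent (((0, 0, v, 0) : Oct), 0) (octIdem, 0) := by
  obtain ⟨w, hw⟩ := exists_dotProduct_eq_one hv
  have h : Oct.mul (0, 0, 0, w) (0, 0, v, 0) = octIdem := by
    simp [Oct.mul, octIdem, hw]
  have := equivalent_mul_left (c := (0, 0, v, 0)) (x := (0, 0, 0, w)) (by simp [Oct.norm])
    (by rw [h]; simp [octIdem])
  rwa [h] at this

theorem equivalent_idem_of_covec {w : Fin 3 → ℂ} (hw : w ≠ 0) :
    Equivalent (((0, 0, 0, w) : Oct), 0) (octIdem, 0) := by
  obtain ⟨q, hq⟩ := exists_crossProduct_ne_zero hw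
  have h : Oct.mul (0, 0, 0, q) (0, 0, 0, w) = (0, 0, crossProduct w q, 0) := by
    simp [Oct.mul]
  have := equivalent_mul_left (c := (0, 0, 0, w)) (x := (0, 0, 0, q)) (by simp [Oct.norm])
    (by rw [h]; simp [hq])
  rw [h] at this
  exact this.trans (equivalent_idem_of_vec hq)

/-- Left multiplication by the complementary idempotent keeps only a and v. Multiplying next by a
covector q orthogonal to v leaves the pure covector aq. -/
theorem equivalent_idem_of_fst {c : Oct} (hc : c.norm = 0) (h : c.1 ≠ 0) :
    Equivalent (c, 0) (octIdem, 0) := by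
  obtain ⟨a, b, v, w⟩ := c
  simp only at h
  obtain ⟨q, hq, hqv⟩ : ∃ q : Fin 3 → ℂ, q ≠ 0 ∧ q ⬝ᵥ v = 0 := by
    by_cases hv : v = 0
    · exact ⟨fun _ => 1, fun h => by simpa using congrFun h 0, by simp [hv]⟩
    · obtain ⟨q, hq⟩ := exists_crossProduct_ne_zero hv
      exact ⟨_, hq, by rw [dotProduct_comm, dot_self_cross]⟩
  have h1 : Oct.mul (1, 0, 0, 0) (a, b, v, w) = (a, 0, v, 0) := by
    simp [Oct.mul]
  have h2 : Oct.mul (0, 0, 0, q) (a, 0, v, 0) = (0, 0, 0, a • q) := by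
    simp [Oct.mul, hqv]
  have h3 := equivalent_mul_left (x := (1, 0, 0, 0)) hc (by rw [h1]; simp [h])
  have h4 := equivalent_mul_left (c := (a, 0, v, 0)) (x := (0, 0, 0, q)) (by simp [Oct.norm])
    (by rw [h2]; simp [h, hq])
  rw [h1] at h3
  rw [h2] at h4
  exact (h3.trans h4).trans (equivalent_idem_of_covec (smul_ne_zero h hq))

theorem equivalent_idem_of_norm {c : Oct} (hc : c.norm = 0) (h : c ≠ 0) :
    Equivalent (c, 0) (octIdem, 0) := by
  obtain ⟨a, b, v, w⟩ := c
  by_cases ha : a = 0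
  · subst ha
    by_cases hw : w = 0
    · subst hw
      by_cases hv : v = 0
      · subst hv
        have hb : b ≠ 0 := by
          rintro rfl
          exact h rfl
        have h1 : Oct.mul (0, b⁻¹, 0, 0) (0, b, 0, 0) = octIdem := by
          simp [Oct.mul, octIdem, hb]
        have h2 := equivalent_mul_left (x := (0, b⁻¹, 0, 0)) hc (by rw [h1]; simp [octIdem])
        rwa [h1] at h2
      · have h1 : Oct.mul (1, 0, 0, 0) (0, b, v, 0) = (0, 0, v, 0) := by
          simp [Oct.mul]
        have h2 := equivalent_mul_left (x := (1, 0, 0, 0)) hc (by rw [h1]; simp [hv])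
        rw [h1] at h2
        exact h2.trans (equivalent_idem_of_vec hv)
    · obtain ⟨q, hq⟩ := exists_dotProduct_eq_one hw
      have h1 : (Oct.mul (0, 0, q, 0) (0, b, v, w)).1 = 1 := by
        simp [Oct.mul, hq]
      have h2 : Oct.mul (0, 0, q, 0) (0, b, v, w) ≠ 0 := fun h => by simp [h] at h1
      exact (equivalent_mul_left hc h2).trans (equivalent_idem_of_fst
        (by rw [Oct.norm_mul, hc, mul_zero]) (by rw [h1]; exact one_ne_zero))
  · exact equivalent_idem_of_fst hc ha

theorem equivalent_idem {u v : Oct} (hu : u.norm = 0) (hv : v.norm = 0) (huv : u.mul v = 0)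
    (h : (u, v) ≠ 0) : Equivalent (u, v) (octIdem, 0) := by
  by_cases hu0 : u = 0
  · subst hu0
    have h1 := equivalent_swap 0 v
    rw [map_zero] at h1
    refine h1.trans (equivalent_idem_of_norm (by rwa [Oct.norm_conj]) fun h2 => h ?_)
    rw [Oct.conj_injective (h2.trans (map_zero _).symm)]
    rfl
  · obtain ⟨w, hw⟩ := Oct.exists_conj_mul_of_mul_eq_zero hu0 huv
    have h1 := equivalent_add_right u v (-w)
    have hneg : ∀ y : Oct, y.mul (-w) = -(y.mul w) := fun y => by
      simpa using Oct.mul_smul (-1) y w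
    rw [hneg, hw, add_neg_cancel] at h1
    exact h1.trans (equivalent_idem_of_norm hu hu0)


/-! ### The elements of rank one and two -/

/-- Both sides lie in 𝔲₋, where an element is determined by its value on the top vector. -/
theorem conj_lower {k : Jordan ≃ₗ[ℂ] Jordan} (hk : k ∈ K) (h0 : k (deg0 1) = deg0 1)
    (u v : Oct) : k.conj (lower (deg1 u v)) = lower (k (deg1 u v)) := by
  have h1 : k.symm (deg0 1) = deg0 1 := by rw [LinearEquiv.symm_apply_eq, h0]
  rw [eq_lower (conj_mem_uMinus hk (lower_mem_uMinus (deg1 u v))), LinearEquiv.conj_apply]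
  simp [h1, lower_deg1_deg0]

theorem Equivalent.exists_conj {x y : Oct × Oct} (h : Equivalent x y) :
    ∃ k ∈ K, lower (deg1 x.1 x.2) = k.conj (lower (deg1 y.1 y.2)) := by
  obtain ⟨k, hk, h0, h1⟩ := h.symm
  exact ⟨k, hk, by rw [conj_lower hk h0, h1]⟩

theorem lower_lower (u v : Oct) : lower (deg1 u v) (deg1 u v) =
    deg2 (2 * v.norm) (Oct.conj ((2 : ℂ) • u.mul v)) (2 * u.norm) := by
  rw [lower_deg1_deg1, Oct.inner_self, Oct.inner_self, two_smul]

theorem lower_lower_eq_zero {u v : Oct} :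
    lower (deg1 u v) (deg1 u v) = 0 ↔ u.norm = 0 ∧ v.norm = 0 ∧ u.mul v = 0 := by
  rw [lower_lower, ← deg2_zero]
  constructor
  · intro h
    obtain ⟨h1, h2, h3⟩ := deg2_injective h
    refine ⟨by simpa using h3, by simpa using h1, ?_⟩
    have h4 := Oct.conj_injective (h2.trans (map_zero _).symm)
    simpa using h4
  · rintro ⟨h1, h2, h3⟩
    simp [h1, h2, h3]

theorem lower_comm (u v u' v' : Oct) :
    lower (deg1 u v) (deg1 u' v') = lower (deg1 u' v') (deg1 u v) := by
  rw [lower_deg1_deg1, lower_deg1_deg1, Oct.inner_comm u, Oct.inner_comm v, add_comm]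

/-- The vanishing of the square of an element of `𝔲₋` on the top vector is `K`-invariant. -/
theorem conj_conj_apply_deg0 {k : Jordan ≃ₗ[ℂ] Jordan} (hk : k ∈ K) (A : Module.End ℂ Jordan) :
    k.conj A (k.conj A (deg0 1)) = 0 ↔ A (A (deg0 1)) = 0 := by
  -- An element of K need not fix the top vector but rescales it by a nonzero factor, which does not
  -- affect vanishing.
  obtain ⟨ξ, hξ⟩ := K_apply_deg0 (K.inv_mem hk) 1
  have hξ' : k.symm (deg0 1) = ξ • deg0 1 := by
    rw [smul_deg0, mul_one]
    exact hξ
  have h0 : ξ ≠ 0 := by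
    rintro rfl
    rw [zero_smul, LinearEquiv.symm_apply_eq, map_zero] at hξ'
    simpa [deg0] using congrArg (fun x : Jordan => x.1 0) hξ'
  rw [LinearEquiv.conj_apply]
  simp [hξ', h0]

/-- The index of a primitive idempotent in the first octonionic coordinate. -/
def index₁ : Index := Sum.inr ⟨1, Sum.inl ()⟩

/-- The index of the complementary idempotent in the first octonionic coordinate. -/
def index₂ : Index := Sum.inr ⟨1, Sum.inr (Sum.inl ())⟩

theorem isDegOne_index₁ : IsDegOne index₁ := one_ne_zero

theorem isDegOne_index₂ : IsDegOne index₂ := one_ne_zero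

theorem basis_index₁ : Jordan.basis index₁ = deg1 (1, 0, 0, 0) 0 := by
  rw [index₁, basis_inr_one]
  congr 1
  apply Oct.ext_coords <;> simp [Oct.basis]

theorem basis_index₂ : Jordan.basis index₂ = deg1 octIdem 0 := by
  rw [index₂, basis_inr_one]
  congr 1
  apply Oct.ext_coords <;> simp [Oct.basis, octIdem]

theorem basis_index_add : Jordan.basis index₁ + Jordan.basis index₂ = deg1 Oct.unit 0 := by
  rw [basis_index₁, basis_index₂, deg1_add]
  simp [octIdem, Oct.unit]

theorem root_generic (k : Index) :
    root k ⟨generic, generic_mem_t⟩ = ((25 - genericWeight k : ℤ) : ℂ) := by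
  rw [root, LinearMap.sub_apply, weight_generic, weight_generic]
  simp [genericWeight]

theorem not_isRoot_sub : ¬ IsRoot (root index₁ - root index₂) := by
  -- On the generic element the two roots take the values 25 - 33 = -8 and 25 + 43 = 68.
  refine not_isRoot_of_genericWeight (i := index₁) (j := index₂) (-76) ?_ (by decide +kernel)
    (k := Sum.inr ⟨0, Sum.inr (Sum.inl ())⟩) (l := Sum.inr ⟨2, Sum.inr (Sum.inl ())⟩)
    (by decide) (by decide) ?_
  · rw [LinearMap.sub_apply, root_generic, root_generic]
    norm_num [genericWeight, index₁, index₂]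
  · rw [polar_eq]
    simp [Jordan.basis, index₂, Oct.basis, Oct.tri, Oct.mul, Oct.tr, Oct.inner]

theorem not_isRoot_sub' : ¬ IsRoot (root index₂ - root index₁) := by
  refine not_isRoot_of_genericWeight (i := index₂) (j := index₁) 76 ?_ (by decide +kernel)
    (k := Sum.inr ⟨0, Sum.inl ()⟩) (l := Sum.inr ⟨2, Sum.inl ()⟩)
    (by decide) (by decide) ?_
  · rw [LinearMap.sub_apply, root_generic, root_generic]
    norm_num [genericWeight, index₁, index₂]
  · rw [polar_eq]
    simp [Jordan.basis, index₁, Oct.basis, Oct.tri, Oct.mul, Oct.tr, Oct.inner]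

theorem not_isRoot_add : ¬ IsRoot (root index₁ + root index₂) := by
  refine not_isRoot_of_genericWeight (i := Sum.inl 2) (j := Sum.inl 0) 60 ?_ (by decide +kernel)
    (k := Sum.inr ⟨0, Sum.inl ()⟩) (l := Sum.inr ⟨0, Sum.inr (Sum.inl ())⟩)
    (by decide) (by decide) ?_
  · rw [LinearMap.add_apply, root_generic, root_generic]
    norm_num [genericWeight, index₁, index₂]
  · rw [polar_eq]
    simp [Jordan.basis, Fin.sum_univ_three, Oct.basis, Oct.tri, Oct.mul, Oct.tr, Oct.inner]

theorem stronglyOrthogonal_one : StronglyOrthogonal (fun _ : Fin 1 => root index₂) := by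
  refine ⟨fun _ => ⟨isRoot_root isDegOne_index₂, root_z isDegOne_index₂⟩, ?_,
    fun i j hij => (hij (Subsingleton.elim i j)).elim⟩
  exact LinearIndependent.of_subsingleton 0 (isRoot_root isDegOne_index₂).1

theorem stronglyOrthogonal_two : StronglyOrthogonal ![root index₁, root index₂] := by
  refine ⟨fun i => ?_, ?_, fun i j hij => ?_⟩
  · fin_cases i
    · exact ⟨isRoot_root isDegOne_index₁, root_z isDegOne_index₁⟩
    · exact ⟨isRoot_root isDegOne_index₂, root_z isDegOne_index₂⟩
  · rw [LinearIndependent.pair_iff]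
    intro a b hab
    have h1 := LinearMap.congr_fun hab ⟨generic, generic_mem_t⟩
    have h2 := LinearMap.congr_fun hab ⟨z, z_mem_t⟩
    simp only [LinearMap.add_apply, LinearMap.smul_apply, root_generic, root_z isDegOne_index₁,
      root_z isDegOne_index₂, LinearMap.zero_apply, smul_eq_mul] at h1 h2
    norm_num [genericWeight, index₁, index₂] at h1
    exact ⟨by linear_combination (-1 / 76 : ℂ) * h1 + 34 / 76 * h2,
      by linear_combination (1 / 76 : ℂ) * h1 + 4 / 76 * h2⟩
  · fin_cases i <;> fin_cases j
    · exact (hij rfl).elim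
    · exact ⟨not_isRoot_add, not_isRoot_sub⟩
    · exact ⟨by simpa [add_comm] using not_isRoot_add, not_isRoot_sub'⟩
    · exact (hij rfl).elim

theorem lower_basis_ne_zero {k : Index} (hk : IsDegOne k) : lower (Jordan.basis k) ≠ 0 := by
  obtain ⟨u, v, huv⟩ := hk.exists_eq
  intro h
  have := LinearMap.congr_fun h (deg0 1)
  rw [huv, lower_deg1_deg0, one_smul, ← huv] at this
  exact Jordan.basis.ne_zero k this

/-- The square of a root vector of 𝔲₋ kills the top vector, and this property is K-invariant.
Conversely the normal form (f, 0) is a basis vector, hence gives a root vector. -/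
theorem hasRank_one_iff {y : uMinus} {u v : Oct}
    (hy : (y : Module.End ℂ Jordan) = lower (deg1 u v)) :
    HasRank y 1 ↔ (u, v) ≠ 0 ∧ u.norm = 0 ∧ v.norm = 0 ∧ u.mul v = 0 := by
  constructor
  · rintro ⟨k, hk, α, hα, e, he, hye⟩
    rw [Fin.sum_univ_one] at hye
    refine ⟨?_, ?_⟩
    · rintro h0
      rw [Prod.mk_eq_zero] at h0
      rw [hy, h0.1, h0.2, deg1_zero, map_zero] at hye
      exact (he 0).2 (k.conj.injective (hye.symm.trans (map_zero _).symm))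
    · obtain ⟨j, hj, -, c, hc, h⟩ := exists_eq_lower_basis (hα.1 0).2 (he 0).1 (he 0).2
      have h1 : e 0 (e 0 (deg0 1)) = 0 := by
        obtain ⟨u', v', huv⟩ := hj.exists_eq
        have h2 := lower_basis_basis hj
        rw [huv] at h2
        rw [h, huv]
        simp [lower_deg1_deg0, h2]
      rw [← conj_conj_apply_deg0 hk, ← hye, hy, lower_deg1_deg0, one_smul] at h1
      exact lower_lower_eq_zero.mp h1
  · rintro ⟨h0, h1, h2, h3⟩
    obtain ⟨k, hk, h⟩ := (equivalent_idem h1 h2 h3 h0).exists_conj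
    refine ⟨k, hk, _, stronglyOrthogonal_one, fun _ => lower (Jordan.basis index₂),
      fun _ => ⟨lower_mem_rootSpace isDegOne_index₂, lower_basis_ne_zero isDegOne_index₂⟩, ?_⟩
    rw [Fin.sum_univ_one, hy, h, basis_index₂]

/-- In the square of a sum of two root vectors applied to the top vector, only the doubled mixed
term survives, and strong orthogonality makes it nonzero. Conversely the normal form (1, 0) splits
as the sum of two complementary idempotents. -/
theorem hasRank_two_iff {y : uMinus} {u v : Oct}
    (hy : (y : Module.End ℂ Jordan) = lower (deg1 u v)) :
    HasRank y 2 ↔ u.norm ≠ 0 ∨ v.norm ≠ 0 ∨ u.mul v ≠ 0 := by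
  constructor
  · rintro ⟨k, hk, α, hα, e, he, hye⟩
    rw [Fin.sum_univ_two] at hye
    by_contra! h0
    have h1 : k.conj (e 0 + e 1) (k.conj (e 0 + e 1) (deg0 1)) = 0 := by
      rw [← hye, hy, lower_deg1_deg0, one_smul, lower_lower_eq_zero]
      exact h0
    obtain ⟨i, hi, hαi, a, ha, hei⟩ := exists_eq_lower_basis (hα.1 0).2 (he 0).1 (he 0).2
    obtain ⟨j, hj, hαj, b, hb, hej⟩ := exists_eq_lower_basis (hα.1 1).2 (he 1).1 (he 1).2
    have h2 : root j - root i ≠ 0 := by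
      rw [← hαi, ← hαj, sub_ne_zero]
      exact hα.2.1.injective.ne one_ne_zero
    have h3 : ¬ IsRoot (root j - root i) := by
      rw [← hαi, ← hαj]
      exact (hα.2.2 1 0 one_ne_zero).2
    refine lower_basis_mul_ne_zero hi hj h2 h3 ?_
    obtain ⟨u₁, v₁, hi'⟩ := hi.exists_eq
    obtain ⟨u₂, v₂, hj'⟩ := hj.exists_eq
    have h4 := lower_basis_basis hi
    have h5 := lower_basis_basis hj
    rw [conj_conj_apply_deg0 hk, hei, hej] at h1
    rw [hi'] at h1 h4 ⊢
    rw [hj'] at h1 h5 ⊢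
    simp only [LinearMap.add_apply, LinearMap.smul_apply, lower_deg1_deg0, one_smul, map_add,
      map_smul, h4, h5, lower_comm u₂ v₂, smul_zero, zero_add, add_zero] at h1
    rw [smul_comm b a, ← two_smul ℂ, smul_smul, smul_smul, smul_eq_zero] at h1
    exact h1.resolve_left (by simp [ha, hb])
  · intro h0
    obtain ⟨k, hk, h⟩ := (equivalent_unit h0).exists_conj
    refine ⟨k, hk, _, stronglyOrthogonal_two,
      ![lower (Jordan.basis index₁), lower (Jordan.basis index₂)], fun i => ?_, ?_⟩
    · fin_cases i
      · exact ⟨lower_mem_rootSpace isDegOne_index₁, lower_basis_ne_zero isDegOne_index₁⟩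
      · exact ⟨lower_mem_rootSpace isDegOne_index₂, lower_basis_ne_zero isDegOne_index₂⟩
    · rw [Fin.sum_univ_two, hy, h]
      simp only [Matrix.cons_val_zero, Matrix.cons_val_one]
      rw [← map_add lower, basis_index_add]


/-! ### Ranks, kernels and images of the maps `λ₂` -/

/-- The parametrisation of the graded piece of degree one. -/
def degOne : Oct × Oct →ₗ[ℂ] Jordan where
  toFun x := deg1 x.1 x.2
  map_add' _ _ := (deg1_add _ _ _ _).symm
  map_smul' _ _ := (smul_deg1 _ _ _).symm

theorem range_degOne : LinearMap.range degOne = E 1 := by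
  ext x
  rw [mem_E_one, LinearMap.mem_range]
  exact ⟨fun ⟨a, ha⟩ => ⟨a.1, a.2, ha.symm⟩, fun ⟨u, v, h⟩ => ⟨(u, v), h.symm⟩⟩

theorem map_E_one (A : Module.End ℂ Jordan) :
    (E 1).map A = LinearMap.range (A ∘ₗ degOne) := by
  rw [LinearMap.range_comp, range_degOne]

theorem map_E_one_of_mem_K {k : Jordan ≃ₗ[ℂ] Jordan} (hk : k ∈ K) :
    (E 1).map (k : Jordan →ₗ[ℂ] Jordan) = E 1 := by
  ext x
  rw [Submodule.mem_map]
  constructor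
  · rintro ⟨y, hy, rfl⟩
    obtain ⟨u, v, rfl⟩ := mem_E_one.mp hy
    exact mem_E_one.mpr (K_apply_deg1 hk u v)
  · intro hx
    obtain ⟨u, v, rfl⟩ := mem_E_one.mp hx
    exact ⟨k.symm (deg1 u v), mem_E_one.mpr (K_apply_deg1 (K.inv_mem hk) u v),
      k.apply_symm_apply _⟩

theorem lower_map {k : Jordan ≃ₗ[ℂ] Jordan} (hk : k ∈ K) (h0 : k (deg0 1) = deg0 1)
    {x : Jordan} (hx : x ∈ E 1) (w : Jordan) : lower (k x) (k w) = k (lower x w) := by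
  obtain ⟨u, v, rfl⟩ := mem_E_one.mp hx
  rw [← conj_lower hk h0, LinearEquiv.conj_apply]
  simp

theorem map_lower_map {k : Jordan ≃ₗ[ℂ] Jordan} (hk : k ∈ K) (h0 : k (deg0 1) = deg0 1)
    {x : Jordan} (hx : x ∈ E 1) :
    (E 1).map (lower (k x)) = ((E 1).map (lower x)).map (k : Jordan →ₗ[ℂ] Jordan) := by
  rw [← Submodule.map_comp]
  conv_lhs => rw [← map_E_one_of_mem_K hk]
  rw [← Submodule.map_comp]
  congr 1
  exact LinearMap.ext fun w => lower_map hk h0 hx w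

theorem finrank_range_comp {V W X : Type*} [AddCommGroup V] [AddCommGroup W] [AddCommGroup X]
    [Module ℂ V] [Module ℂ W] [Module ℂ X] {p : V →ₗ[ℂ] W} {i : W →ₗ[ℂ] X}
    (hp : Function.Surjective p) (hi : Function.Injective i) :
    Module.finrank ℂ (LinearMap.range (i ∘ₗ p)) = Module.finrank ℂ W := by
  rw [LinearMap.range_comp_of_range_eq_top _ (LinearMap.range_eq_top.mpr hp),
    LinearMap.finrank_range_of_inj hi]

theorem finrank_map_lower_unit :
    Module.finrank ℂ ((E 1).map (lower (deg1 Oct.unit 0))) = 9 := by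
  let p : Oct × Oct →ₗ[ℂ] Oct × ℂ :=
    { toFun := fun x => (x.2, Oct.unit.inner x.1)
      map_add' := fun x y => by simp [Oct.inner_add_right]
      map_smul' := fun c x => by simp [Oct.inner_smul_right] }
  let i : Oct × ℂ →ₗ[ℂ] Jordan :=
    { toFun := fun x => deg2 0 (Oct.conj x.1) x.2
      map_add' := fun x y => by simp [deg2_add]
      map_smul' := fun c x => by simp [smul_deg2] }
  have h : lower (deg1 Oct.unit 0) ∘ₗ degOne = i ∘ₗ p := by
    refine LinearMap.ext fun x => ?_
    change lower (deg1 Oct.unit 0) (deg1 x.1 x.2) = deg2 0 (Oct.conj x.2) (Oct.unit.inner x.1)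
    rw [lower_deg1_deg1, Oct.zero_inner, Oct.mul_zero, Oct.unit_mul, add_zero]
  rw [map_E_one, h, finrank_range_comp]
  · simp [Oct]
  · rintro ⟨c, s⟩
    obtain ⟨y, hy⟩ := Oct.exists_inner_eq_one (x := Oct.unit) (by simp [Oct.unit])
    exact ⟨(s • y, c), by simp [p, Oct.inner_smul_right, hy]⟩
  · rintro ⟨c, s⟩ ⟨c', s'⟩ h
    obtain ⟨-, h1, h2⟩ := deg2_injective h
    exact Prod.ext (Oct.conj_injective h1) h2

/-- The image of `λ₂` for the standard element of rank one. -/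
theorem map_lower_idem : ∃ i : (ℂ × ℂ × (Fin 3 → ℂ)) →ₗ[ℂ] Jordan,
    (∀ s b w, i (s, b, w) = deg2 0 (Oct.conj (0, b, 0, w)) s) ∧ Function.Injective i ∧
      (E 1).map (lower (deg1 octIdem 0)) = LinearMap.range i := by
  let p : Oct × Oct →ₗ[ℂ] ℂ × ℂ × (Fin 3 → ℂ) :=
    { toFun := fun x => (x.1.1, x.2.2.1, x.2.2.2.2)
      map_add' := fun x y => by simp
      map_smul' := fun c x => by simp }
  let i : (ℂ × ℂ × (Fin 3 → ℂ)) →ₗ[ℂ] Jordan :=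
    { toFun := fun x => deg2 0 (Oct.conj (0, x.2.1, 0, x.2.2)) x.1
      map_add' := fun x y => by simp [deg2_add, ← map_add]
      map_smul' := fun c x => by simp [smul_deg2, ← map_smul] }
  have h : lower (deg1 octIdem 0) ∘ₗ degOne = i ∘ₗ p := by
    refine LinearMap.ext fun x => ?_
    change lower (deg1 octIdem 0) (deg1 x.1 x.2) =
      deg2 0 (Oct.conj (0, x.2.2.1, 0, x.2.2.2.2)) x.1.1
    rw [lower_deg1_deg1, Oct.zero_inner, Oct.mul_zero, add_zero]
    congr 2
    · simp [octIdem, Oct.mul]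
    · simp [octIdem, Oct.inner]
  refine ⟨i, fun s b w => rfl, ?_, ?_⟩
  · rintro ⟨c, s, w⟩ ⟨c', s', w'⟩ h
    obtain ⟨-, h1, h2⟩ := deg2_injective h
    have h3 := Oct.conj_injective h1
    simp only [Prod.mk.injEq] at h3 h2 ⊢
    exact ⟨h2, h3.2.1, h3.2.2.2⟩
  · rw [map_E_one, h, LinearMap.range_comp_of_range_eq_top]
    rw [LinearMap.range_eq_top]
    rintro ⟨s, b, w⟩
    exact ⟨((s, 0, 0, 0), (0, b, 0, w)), rfl⟩

theorem finrank_map_lower_idem :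
    Module.finrank ℂ ((E 1).map (lower (deg1 octIdem 0))) = 5 := by
  obtain ⟨i, -, hi, h⟩ := map_lower_idem
  rw [h, LinearMap.finrank_range_of_inj hi]
  simp

theorem finrank_map_lower_of_equivalent {x y : Oct × Oct} (h : Equivalent x y) :
    Module.finrank ℂ ((E 1).map (lower (deg1 x.1 x.2))) =
      Module.finrank ℂ ((E 1).map (lower (deg1 y.1 y.2))) := by
  obtain ⟨k, hk, h0, h1⟩ := h
  rw [← h1, map_lower_map hk h0 (mem_E_one.mpr ⟨_, _, rfl⟩)]
  exact (LinearEquiv.finrank_map_eq k _).symm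

/-! ### Planes of elements of rank two -/

/-- The polarised norm form as a bilinear form. -/
def innerForm : LinearMap.BilinForm ℂ Oct :=
  LinearMap.mk₂ ℂ Oct.inner Oct.inner_add_left Oct.inner_smul_left Oct.inner_add_right
    Oct.inner_smul_right

/-- A totally isotropic subspace lies in its orthogonal, and the two dimensions add up to 8. -/
theorem finrank_le_four {V : Submodule ℂ Oct} (hV : ∀ b ∈ V, b.norm = 0) :
    Module.finrank ℂ V ≤ 4 := by
  have hs : innerForm.IsRefl := fun x y h => by
    change x.inner y = 0 at h
    change y.inner x = 0
    rw [Oct.inner_comm, h]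
  have hn : innerForm.Nondegenerate :=
    hs.nondegenerate_iff_separatingLeft.mpr fun x hx => Oct.eq_zero_of_inner hx
  have h1 := LinearMap.BilinForm.finrank_orthogonal hn V
  have h2 : V ≤ innerForm.orthogonal V := fun x hx y hy => by
    change y.inner x = 0
    have := Oct.norm_add y x
    rw [hV _ hx, hV _ hy, hV _ (V.add_mem hy hx)] at this
    simpa using this.symm
  have h3 := Submodule.finrank_mono h2
  have h4 : Module.finrank ℂ Oct = 8 := by simp [Oct]
  omega

/-- The elements of degree one annihilated by two elements of `𝔲₋`. -/
def commonKernel (x y : Jordan) : Submodule ℂ Jordan :=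
  E 1 ⊓ (LinearMap.ker (lower x) ⊓ LinearMap.ker (lower y))

theorem finrank_commonKernel_map {k : Jordan ≃ₗ[ℂ] Jordan} (hk : k ∈ K)
    (h0 : k (deg0 1) = deg0 1) {x y : Jordan} (hx : x ∈ E 1) (hy : y ∈ E 1) :
    Module.finrank ℂ (commonKernel x y) ≤ Module.finrank ℂ (commonKernel (k x) (k y)) := by
  rw [← LinearEquiv.finrank_map_eq k]
  refine Submodule.finrank_mono ?_
  rintro _ ⟨w, ⟨hw, hw1, hw2⟩, rfl⟩
  rw [SetLike.mem_coe, LinearMap.mem_ker] at hw1 hw2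
  refine ⟨?_, ?_, ?_⟩
  · rw [← map_E_one_of_mem_K hk]
    exact Submodule.mem_map_of_mem hw
  · rw [SetLike.mem_coe, LinearMap.mem_ker]
    exact (lower_map hk h0 hx w).trans (by rw [hw1, map_zero])
  · rw [SetLike.mem_coe, LinearMap.mem_ker]
    exact (lower_map hk h0 hy w).trans (by rw [hw2, map_zero])

/-- The kernel at (1, 0) consists of the pairs (b, 0) with b of trace zero, and the second element
adds bq = 0. Such b are null because q ≠ 0, so they span an isotropic space. -/
theorem finrank_commonKernel_unit {p q : Oct} (hq : q ≠ 0) :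
    Module.finrank ℂ (commonKernel (deg1 Oct.unit 0) (deg1 p q)) ≤ 3 := by
  let R : Oct →ₗ[ℂ] Oct :=
    { toFun := fun b => b.mul q
      map_add' := fun x y => Oct.add_mul _ _ _
      map_smul' := fun c x => Oct.smul_mul _ _ _ }
  let V : Submodule ℂ Oct := LinearMap.ker R
  let V' : Submodule ℂ Oct := V ⊓ LinearMap.ker (innerForm Oct.unit)
  let i : Oct →ₗ[ℂ] Jordan := degOne ∘ₗ LinearMap.inl ℂ Oct Oct
  have h1 : commonKernel (deg1 Oct.unit 0) (deg1 p q) ≤ V'.map i := by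
    rintro w ⟨hw, hw1, hw2⟩
    obtain ⟨b, c, rfl⟩ := mem_E_one.mp hw
    rw [SetLike.mem_coe, LinearMap.mem_ker, lower_deg1_deg1, ← deg2_zero] at hw1 hw2
    obtain ⟨-, h3, h4⟩ := deg2_injective hw1
    obtain ⟨-, h5, -⟩ := deg2_injective hw2
    rw [Oct.unit_mul, Oct.mul_zero, add_zero] at h3
    have hc : c = 0 := Oct.conj_injective (h3.trans (map_zero _).symm)
    subst hc
    refine ⟨b, ⟨?_, h4⟩, rfl⟩
    rw [Oct.mul_zero, zero_add] at h5
    exact Oct.conj_injective (h5.trans (map_zero _).symm)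
  refine (Submodule.finrank_mono h1).trans ((Submodule.finrank_map_le i V').trans ?_)
  have hV : Module.finrank ℂ V ≤ 4 :=
    finrank_le_four fun b hb => Oct.norm_eq_zero_of_mul_eq_zero hq hb
  by_cases hn : q.norm = 0
  · have hlt : V' < V := by
      refine lt_of_le_of_ne inf_le_left fun h => ?_
      obtain ⟨w, hw⟩ := Oct.exists_inner_eq_one hq
      -- For null q, wq̄ annihilates q on the right and has trace ⟨w, q⟩ = 1, so the trace condition
      -- cuts the dimension by at least one.
      have h2 : w.mul (Oct.conj q) ∈ V := by
        change (w.mul (Oct.conj q)).mul q = 0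
        rw [Oct.mul_conj_mul', hn, zero_smul]
      rw [← h] at h2
      have h3 : Oct.unit.inner (w.mul (Oct.conj q)) = 0 := h2.2
      rw [← Oct.tr_mul_conj, Oct.unit_mul, Oct.tr_conj, Oct.tr_mul_conj, Oct.inner_comm, hw] at h3
      exact one_ne_zero h3
    have := Submodule.finrank_lt_finrank_of_lt hlt
    omega
  · have : V' = ⊥ := by
      rw [eq_bot_iff]
      rintro b ⟨hb, -⟩
      have h2 := Oct.mul_mul_conj q b
      rw [show b.mul q = 0 from hb, Oct.zero_mul] at h2
      exact (smul_eq_zero.mp h2.symm).resolve_left hn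
    rw [this, finrank_bot]
    omega

theorem finrank_commonKernel_le {x y : Jordan} (hx : x ∈ E 1) (hy : y ∈ E 1)
    (h : ∀ a b : ℂ, (a, b) ≠ (0, 0) → lower (a • x + b • y) (a • x + b • y) ≠ 0) :
    Module.finrank ℂ (commonKernel x y) ≤ 3 := by
  obtain ⟨u, v, rfl⟩ := mem_E_one.mp hx
  have h1 := h 1 0 (by simp)
  rw [one_smul, zero_smul, add_zero, Ne, lower_lower_eq_zero] at h1
  obtain ⟨k, hk, h0, hk1⟩ := equivalent_unit (u := u) (v := v) (by tauto)
  refine (finrank_commonKernel_map hk h0 hx hy).trans ?_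
  obtain ⟨p', q', rfl⟩ := mem_E_one.mp hy
  obtain ⟨p, q, hpq⟩ := K_apply_deg1 hk p' q'
  simp only at hk1
  rw [hk1, hpq]
  refine finrank_commonKernel_unit fun hq => ?_
  -- If q = 0, completing the square solves N(r·1 + p) = 0 with r = s - ⟨1, p⟩/2. The corresponding
  -- combination r x + y has κ = 0, against the hypothesis.
  obtain ⟨s, hs⟩ := IsAlgClosed.exists_eq_mul_self ((Oct.unit.inner p / 2) ^ 2 - p.norm)
  refine h (s - Oct.unit.inner p / 2) 1 (by simp) ?_
  apply k.injective
  rw [← lower_map hk h0 (Submodule.add_mem _ (Submodule.smul_mem _ _ hx)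
    (Submodule.smul_mem _ _ hy)), map_add, map_smul, map_smul, hk1, hpq, hq, map_zero, smul_deg1,
    smul_deg1, deg1_add, lower_lower_eq_zero]
  simp only [smul_zero, add_zero, Oct.mul_zero, Oct.norm_zero, and_self, and_true, one_smul]
  rw [Oct.norm_add, Oct.norm_smul, Oct.norm_unit, Oct.inner_smul_left]
  linear_combination -hs

/-! ### Elements of rank one with a large common image -/

/-- A subspace of codimension at most one meets the span of any two vectors: otherwise I ⊕ ℂ² would
embed in L. -/
theorem exists_mem_of_finrank_le {V : Type*} [AddCommGroup V] [Module ℂ V] [FiniteDimensional ℂ V]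
    {I L : Submodule ℂ V} (hIL : I ≤ L)
    (h : Module.finrank ℂ L ≤ Module.finrank ℂ I + 1) {a b : V} (ha : a ∈ L) (hb : b ∈ L) :
    ∃ s t : ℂ, (s ≠ 0 ∨ t ≠ 0) ∧ s • a + t • b ∈ I := by
  by_contra! hcon
  let f : I × ℂ × ℂ →ₗ[ℂ] L :=
    LinearMap.coprod (Submodule.inclusion hIL) (LinearMap.coprod
      (LinearMap.toSpanSingleton ℂ L ⟨a, ha⟩) (LinearMap.toSpanSingleton ℂ L ⟨b, hb⟩))
  have hf : Function.Injective f := by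
    rw [← LinearMap.ker_eq_bot, LinearMap.ker_eq_bot']
    rintro ⟨i, s, t⟩ hst
    have h1 : (i : V) + (s • a + t • b) = 0 := congrArg Subtype.val hst
    have h2 : s • a + t • b ∈ I := by
      rw [← neg_eq_of_add_eq_zero_right h1]
      exact I.neg_mem i.2
    have h3 : s = 0 ∧ t = 0 := by
      by_contra hne
      exact hcon s t (by tauto) h2
    rw [h3.1, h3.2, zero_smul, zero_smul, add_zero, add_zero] at h1
    ext <;> simp [h1, h3]
  have := LinearMap.finrank_le_finrank_of_injective hf
  simp at this
  omega

/-- Necessary equations for the image of λ₂ at a null pair: here d = pc + bq with η = ⟨q, c⟩ and ζ =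
⟨p, b⟩, and alternativity together with pq = 0 evaluates both products. -/
theorem mul_conj_of_mem_map_lower {p q : Oct} (hp : p.norm = 0) (hq : q.norm = 0)
    (hpq : p.mul q = 0) {η ζ : ℂ} {d : Oct}
    (h : deg2 η (Oct.conj d) ζ ∈ (E 1).map (lower (deg1 p q))) :
    d.mul (Oct.conj q) = η • p ∧ (Oct.conj p).mul d = ζ • q := by
  obtain ⟨w, hw, hw'⟩ := h
  obtain ⟨b, c, rfl⟩ := mem_E_one.mp hw
  rw [lower_deg1_deg1] at hw'
  obtain ⟨rfl, h2, rfl⟩ := deg2_injective hw'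
  rw [← Oct.conj_injective h2, Oct.add_mul, Oct.mul_add, Oct.mul_mul_conj, Oct.conj_mul_mul, hp, hq,
    zero_smul, zero_smul, add_zero, zero_add]
  constructor
  · rw [← Oct.mul_mul_conj_add, hpq, Oct.zero_mul, zero_add]
  · rw [← Oct.conj_mul_mul_add, hpq, Oct.mul_zero, add_zero]

theorem eq_smul_of_finrank_idem {p q : Oct} (hp : p.norm = 0) (hq : q.norm = 0)
    (hpq : p.mul q = 0)
    (h : 4 ≤ Module.finrank ℂ
      ↥((E 1).map (lower (deg1 octIdem 0)) ⊓ (E 1).map (lower (deg1 p q)))) :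
    ∃ c : ℂ, deg1 p q = c • deg1 octIdem 0 := by
  obtain ⟨i, hi, -, hL⟩ := map_lower_idem
  -- The image at the idempotent has dimension 5, so the intersection has codimension at most one in
  -- it. Every pair of its elements has a nontrivial combination in the second image, and there η =
  -- 0.
  have key : ∀ a b : ℂ × ℂ × (Fin 3 → ℂ), ∃ σ τ : ℂ, (σ ≠ 0 ∨ τ ≠ 0) ∧
      Oct.mul (0, σ * a.2.1 + τ * b.2.1, 0, σ • a.2.2 + τ • b.2.2) (Oct.conj q) = 0 ∧
      (Oct.conj p).mul (0, σ * a.2.1 + τ * b.2.1, 0, σ • a.2.2 + τ • b.2.2) =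
        (σ * a.1 + τ * b.1) • q := by
    intro a b
    obtain ⟨σ, τ, hne, hmem⟩ := exists_mem_of_finrank_le
      (I := (E 1).map (lower (deg1 octIdem 0)) ⊓ (E 1).map (lower (deg1 p q))) inf_le_left
      (by rw [finrank_map_lower_idem]; omega) (a := i a) (b := i b)
      (by rw [hL]; exact ⟨a, rfl⟩) (by rw [hL]; exact ⟨b, rfl⟩)
    have h1 : σ • i a + τ • i b = deg2 0
        (Oct.conj (0, σ * a.2.1 + τ * b.2.1, 0, σ • a.2.2 + τ • b.2.2)) (σ * a.1 + τ * b.1) := by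
      rw [← map_smul, ← map_smul, ← map_add, ← hi]
      rfl
    have h2 := hmem.2
    rw [h1] at h2
    have h3 := mul_conj_of_mem_map_lower hp hq hpq h2
    rw [zero_smul] at h3
    exact ⟨σ, τ, hne, h3⟩
  obtain ⟨qa, qb, qv, qw⟩ := q
  obtain ⟨pa, pb, pv, pw⟩ := p
  have hq0 : ((qa, qb, qv, qw) : Oct) = 0 := by
    by_contra hne
    have h1 : ∀ (β : ℂ) (ω : Fin 3 → ℂ),
        Oct.mul (0, β, 0, ω) (Oct.conj (qa, qb, qv, qw)) = 0 := by
      intro β ω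
      -- The first vector has d = 0 and ζ = 1, so it alone would give q = 0. The other one must
      -- therefore contribute, and its d is annihilated by q̄ for every β and ω.
      obtain ⟨σ, τ, h0, h1, h2⟩ := key (1, 0, 0) (0, β, ω)
      have hτ : τ ≠ 0 := by
        rintro rfl
        simp only [mul_zero, zero_mul, zero_smul, smul_zero, add_zero, mul_one] at h2
        rw [show ((0, 0, 0, 0) : Oct) = 0 from rfl, Oct.mul_zero, eq_comm, smul_eq_zero] at h2
        simp only [ne_eq, not_true_eq_false, or_false] at h0
        exact h2.elim h0 hne
      have h3 : ((0, σ * 0 + τ * β, 0, σ • (0 : Fin 3 → ℂ) + τ • ω) : Oct) = τ • (0, β, 0, ω) := by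
        simp
      simp only at h1
      rw [h3, Oct.smul_mul, smul_eq_zero] at h1
      exact h1.resolve_left hτ
    have h2 := h1 1 0
    simp [Oct.mul, Oct.conj_apply] at h2
    have h3 : ∀ ω : Fin 3 → ℂ, ω ⬝ᵥ qv = 0 ∧ qb • ω = 0 := fun ω => by
      have h4 := h1 0 ω
      simp [Oct.mul, Oct.conj_apply] at h4
      refine ⟨h4.1, ?_⟩
      rw [smul_eq_zero]
      exact h4.2.2
    have hv : qv = 0 := by
      by_contra hv
      obtain ⟨ω, hω⟩ := exists_dotProduct_eq_one hv
      rw [(h3 ω).1] at hω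
      exact zero_ne_one hω
    have hb : qb = 0 := by
      simpa using congrFun (h3 (fun _ => 1)).2 0
    exact hne (by rw [h2.1, h2.2, hv, hb]; rfl)
  rw [hq0] at key ⊢
  -- With q = 0 the remaining equation is p̄d = 0, written in coordinates. Each coordinate of p
  -- other than `pb` is eliminated by a pair of vectors d no nontrivial combination of which
  -- satisfies it.
  have key' : ∀ (β β' : ℂ) (ω ω' : Fin 3 → ℂ), ∃ σ τ : ℂ, (σ ≠ 0 ∨ τ ≠ 0) ∧
      pv ⬝ᵥ (σ • ω + τ • ω') = 0 ∧ pa * (σ * β + τ * β') = 0 ∧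
      crossProduct pw (σ • ω + τ • ω') = (σ * β + τ * β') • pv ∧
      pa • (σ • ω + τ • ω') = 0 := by
    intro β β' ω ω'
    obtain ⟨σ, τ, h0, -, h2⟩ := key (0, β, ω) (0, β', ω')
    refine ⟨σ, τ, h0, ?_⟩
    simp only [Oct.mul, Oct.conj_apply, smul_zero, Prod.mk_eq_zero] at h2
    obtain ⟨h3, h4, h5, h6⟩ := h2
    refine ⟨?_, by simpa using h4, ?_, by simpa using h6⟩
    · simp at h3 ⊢
      linear_combination -h3
    rw [← sub_eq_zero, ← h5, map_neg, LinearMap.neg_apply, zero_add, smul_neg, sub_neg_eq_add,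
      neg_add_eq_sub]
  have hpa : pa = 0 := by
    by_contra hne
    obtain ⟨σ, τ, h0, -, h1, -, h2⟩ := key' 1 0 0 (fun _ => 1)
    have h3 : σ = 0 := by simpa [hne] using h1
    have h4 : τ = 0 := by simpa [hne] using congrFun h2 0
    exact h0.elim (fun h => h h3) (fun h => h h4)
  have hpv : pv = 0 := by
    by_contra hne
    obtain ⟨ω, hω⟩ := exists_dotProduct_eq_one hne
    obtain ⟨σ, τ, h0, h1, -, h2, -⟩ := key' 1 0 0 ω
    have h3 : τ = 0 := by simpa [dotProduct_comm pv, hω] using h1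
    have h4 : σ = 0 := by
      simp [h3] at h2
      exact (smul_eq_zero.mp h2.symm).resolve_right hne
    exact h0.elim (fun h => h h4) (fun h => h h3)
  have hpw : pw = 0 := by
    have h1 : ∀ ω ω' : Fin 3 → ℂ, ∃ σ τ : ℂ, (σ ≠ 0 ∨ τ ≠ 0) ∧
        crossProduct pw (σ • ω + τ • ω') = 0 := fun ω ω' => by
      obtain ⟨σ, τ, h0, -, -, h2, -⟩ := key' 0 0 ω ω'
      exact ⟨σ, τ, h0, by rw [h2, hpv, smul_zero]⟩
    funext i
    by_contra hne
    rw [Pi.zero_apply] at hne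
    fin_cases i
    · obtain ⟨σ, τ, h0, h2⟩ := h1 (Pi.single 1 1) (Pi.single 2 1)
      rw [cross_apply] at h2
      have h3 := congrFun h2 1
      have h4 := congrFun h2 2
      simp at h3 h4 hne
      tauto
    · obtain ⟨σ, τ, h0, h2⟩ := h1 (Pi.single 0 1) (Pi.single 2 1)
      rw [cross_apply] at h2
      have h3 := congrFun h2 0
      have h4 := congrFun h2 2
      simp at h3 h4 hne
      tauto
    · obtain ⟨σ, τ, h0, h2⟩ := h1 (Pi.single 0 1) (Pi.single 1 1)
      rw [cross_apply] at h2
      have h3 := congrFun h2 0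
      have h4 := congrFun h2 1
      simp at h3 h4 hne
      tauto
  refine ⟨pb, ?_⟩
  rw [smul_deg1, smul_zero, hpa, hpv, hpw]
  simp [octIdem]

theorem eq_smul_of_finrank {x y : Jordan} (hx : x ∈ E 1) (hy : y ∈ E 1) (hx0 : x ≠ 0)
    (hxx : lower x x = 0) (hyy : lower y y = 0)
    (h : 4 ≤ Module.finrank ℂ ↥((E 1).map (lower x) ⊓ (E 1).map (lower y))) :
    ∃ c : ℂ, y = c • x := by
  obtain ⟨u, v, rfl⟩ := mem_E_one.mp hx
  have hxx' := lower_lower_eq_zero.mp hxx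
  obtain ⟨k, hk, h0, hk1⟩ := equivalent_idem hxx'.1 hxx'.2.1 hxx'.2.2 fun huv => hx0 (by
    rw [Prod.mk_eq_zero] at huv
    rw [huv.1, huv.2, deg1_zero])
  obtain ⟨p', q', rfl⟩ := mem_E_one.mp hy
  obtain ⟨p, q, hpq⟩ := K_apply_deg1 hk p' q'
  simp only at hk1
  have hyy' : lower (deg1 p q) (deg1 p q) = 0 := by
    rw [← hpq, lower_map hk h0 hy, hyy, map_zero]
  obtain ⟨hp, hq, hpq0⟩ := lower_lower_eq_zero.mp hyy'
  obtain ⟨c, hc⟩ := eq_smul_of_finrank_idem hp hq hpq0 (by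
    rw [← hk1, ← hpq, map_lower_map hk h0 hx, map_lower_map hk h0 hy,
      ← Submodule.map_inf _ k.injective]
    exact h.trans_eq (LinearEquiv.finrank_map_eq k _).symm)
  exact ⟨c, k.injective (by rw [map_smul, hk1, hpq, hc])⟩

end E6

/-! ### Transfer to λ₂, κ and α; equivariance and coordinates -/

namespace E6

open Jordan commutatorElement

theorem hasRank_one_iff_lower {y : uMinus} {x : Jordan} (hx : x ∈ E 1)
    (hy : (y : Module.End ℂ Jordan) = lower x) : HasRank y 1 ↔ x ≠ 0 ∧ lower x x = 0 := by
  obtain ⟨u, v, rfl⟩ := mem_E_one.mp hx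
  rw [hasRank_one_iff hy, lower_lower_eq_zero]
  refine and_congr_left fun _ => not_congr ⟨fun h => ?_, fun h => ?_⟩
  · rw [Prod.mk_eq_zero] at h
    rw [h.1, h.2, deg1_zero]
  · obtain ⟨h1, h2⟩ := deg1_injective (h.trans deg1_zero.symm)
    rw [h1, h2]
    rfl

theorem hasRank_two_iff_lower {y : uMinus} {x : Jordan} (hx : x ∈ E 1)
    (hy : (y : Module.End ℂ Jordan) = lower x) : HasRank y 2 ↔ lower x x ≠ 0 := by
  obtain ⟨u, v, rfl⟩ := mem_E_one.mp hx
  have := lower_lower_eq_zero (u := u) (v := v)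
  rw [hasRank_two_iff hy]
  tauto

theorem finrank_map_lower_eq_five {x : Jordan} (hx : x ∈ E 1) (hx0 : x ≠ 0)
    (h : lower x x = 0) : Module.finrank ℂ ((E 1).map (lower x)) = 5 := by
  obtain ⟨u, v, rfl⟩ := mem_E_one.mp hx
  obtain ⟨h1, h2, h3⟩ := lower_lower_eq_zero.mp h
  rw [finrank_map_lower_of_equivalent (equivalent_idem h1 h2 h3 fun huv => hx0 (by
    rw [Prod.mk_eq_zero] at huv
    rw [huv.1, huv.2, deg1_zero])), finrank_map_lower_idem]

theorem finrank_map_lower_eq_nine {x : Jordan} (hx : x ∈ E 1) (h : lower x x ≠ 0) :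
    Module.finrank ℂ ((E 1).map (lower x)) = 9 := by
  obtain ⟨u, v, rfl⟩ := mem_E_one.mp hx
  rw [Ne, lower_lower_eq_zero] at h
  rw [finrank_map_lower_of_equivalent (equivalent_unit (u := u) (v := v) (by tauto)),
    finrank_map_lower_unit]

theorem map_subtype_range_lambda₂ (y : uMinus) :
    (LinearMap.range (lambda₂ y)).map (E 2).subtype = (E 1).map (y : Module.End ℂ Jordan) := by
  ext x
  simp only [Submodule.mem_map, LinearMap.mem_range]
  constructor
  · rintro ⟨_, ⟨w, rfl⟩, rfl⟩
    exact ⟨w, w.2, rfl⟩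
  · rintro ⟨w, hw, rfl⟩
    exact ⟨_, ⟨⟨w, hw⟩, rfl⟩, rfl⟩

theorem finrank_range_lambda₂ (y : uMinus) : Module.finrank ℂ (LinearMap.range (lambda₂ y)) =
    Module.finrank ℂ ((E 1).map (y : Module.End ℂ Jordan)) := by
  rw [← map_subtype_range_lambda₂, Submodule.finrank_map_subtype_eq]

theorem finrank_range_inf_range_lambda₂ (y y' : uMinus) :
    Module.finrank ℂ ↥(LinearMap.range (lambda₂ y) ⊓ LinearMap.range (lambda₂ y')) =
      Module.finrank ℂ
        ↥((E 1).map (y : Module.End ℂ Jordan) ⊓ (E 1).map (y' : Module.End ℂ Jordan)) := by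
  rw [← map_subtype_range_lambda₂, ← map_subtype_range_lambda₂,
    ← Submodule.map_inf _ (E 2).injective_subtype, Submodule.finrank_map_subtype_eq]

theorem finrank_ker_inf_ker_lambda₂ {y y' : uMinus} {x x' : Jordan}
    (hy : (y : Module.End ℂ Jordan) = lower x) (hy' : (y' : Module.End ℂ Jordan) = lower x') :
    Module.finrank ℂ ↥(LinearMap.ker (lambda₂ y) ⊓ LinearMap.ker (lambda₂ y')) =
      Module.finrank ℂ (commonKernel x x') := by
  rw [← Submodule.finrank_map_subtype_eq (E 1)]
  suffices h : (LinearMap.ker (lambda₂ y) ⊓ LinearMap.ker (lambda₂ y')).map (E 1).subtype =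
      commonKernel x x' by rw [h]
  rw [commonKernel, ← hy, ← hy']
  ext w
  simp only [Submodule.mem_map, Submodule.mem_inf, LinearMap.mem_ker]
  constructor
  · rintro ⟨v, ⟨h1, h2⟩, rfl⟩
    exact ⟨v.2, congrArg Subtype.val h1, congrArg Subtype.val h2⟩
  · rintro ⟨h, h1, h2⟩
    exact ⟨⟨w, h⟩, ⟨Subtype.ext h1, Subtype.ext h2⟩, rfl⟩

/-- The identification of the graded piece of degree one with `𝔲₋` given by the choice of a
nonzero multiple of the top vector. -/
def alphaEquiv {c : ℂ} (hc : c ≠ 0) : E 1 ≃ₗ[ℂ] uMinus where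
  toFun x := ⟨lower (c⁻¹ • (x : Jordan)), lower_mem_uMinus _⟩
  map_add' x y := Subtype.ext (by simp)
  map_smul' a x := Subtype.ext (by
    change lower (c⁻¹ • a • (x : Jordan)) = a • lower (c⁻¹ • (x : Jordan))
    rw [smul_comm, map_smul])
  invFun y := ⟨(y : Module.End ℂ Jordan) (deg0 c), mem_E_one.mpr (uMinus_apply_deg0 y.2 c)⟩
  left_inv x := by
    obtain ⟨x, hx⟩ := x
    obtain ⟨u, v, rfl⟩ := mem_E_one.mp hx
    apply Subtype.ext
    simp only [map_smul, LinearMap.smul_apply, lower_deg1_deg0]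
    rw [smul_smul, inv_mul_cancel₀ hc, one_smul]
  right_inv y := by
    apply Subtype.ext
    have h : deg0 c = c • deg0 1 := by rw [smul_deg0, mul_one]
    simp only [h, map_smul]
    rw [smul_smul, inv_mul_cancel₀ hc, one_smul]
    exact (eq_lower y.2).symm

theorem coe_alphaEquiv {c : ℂ} (hc : c ≠ 0) (x : E 1) :
    (alphaEquiv hc x : Module.End ℂ Jordan) = lower (c⁻¹ • (x : Jordan)) := rfl

theorem coe_kappa_alphaEquiv {c : ℂ} (hc : c ≠ 0) (x : E 1) :
    (kappa (alphaEquiv hc) x : Jordan) = lower (c⁻¹ • (x : Jordan)) x := rfl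

/-- The derived subgroup of `K` fixes the top vector. -/
theorem Spin10_apply_deg0 {k : Jordan ≃ₗ[ℂ] Jordan} (hk : k ∈ Spin10) :
    k ∈ K ∧ k (deg0 1) = deg0 1 := by
  have h : Spin10 ≤ K ⊓ MulAction.stabilizer (Jordan ≃ₗ[ℂ] Jordan) (deg0 1) := by
    refine Subgroup.commutator_le.mpr fun a ha b hb => ⟨?_, ?_⟩
    · rw [commutatorElement_def]
      exact K.mul_mem (K.mul_mem (K.mul_mem ha hb) (K.inv_mem ha)) (K.inv_mem hb)
    · have hs : ∀ k ∈ K, ∃ ξ : ℂ, k (deg0 1) = ξ • deg0 1 := fun k hk => by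
        obtain ⟨ξ, h⟩ := K_apply_deg0 hk 1
        exact ⟨ξ, by rw [h, smul_deg0, mul_one]⟩
      obtain ⟨α, hα⟩ := hs a ha
      obtain ⟨β, hβ⟩ := hs b hb
      obtain ⟨γ, hγ⟩ := hs (b * a)⁻¹ (K.inv_mem (K.mul_mem hb ha))
      have h1 : (b * a) ((b * a)⁻¹ (deg0 1)) = deg0 1 := (b * a).apply_symm_apply _
      rw [show ⁅a, b⁆ = (a * b) * (b * a)⁻¹ by rw [commutatorElement_def]; group]
      change a (b ((b * a)⁻¹ (deg0 1))) = deg0 1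
      change b (a ((b * a)⁻¹ (deg0 1))) = deg0 1 at h1
      rw [hγ, map_smul, map_smul, hα, map_smul, hβ] at h1
      rw [hγ, map_smul, map_smul, hβ, map_smul, hα, smul_comm β α]
      exact h1
  exact h hk

/-- The octonionic coordinates on the graded piece of degree one. -/
def coordsOne : E 1 ≃ₗ[ℂ] Oct × Oct where
  toFun x := ((x : Jordan).2 1, (x : Jordan).2 2)
  map_add' x y := rfl
  map_smul' a x := rfl
  invFun a := ⟨deg1 a.1 a.2, mem_E_one.mpr ⟨_, _, rfl⟩⟩
  left_inv x := by
    obtain ⟨x, hx⟩ := x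
    obtain ⟨u, v, rfl⟩ := mem_E_one.mp hx
    rfl
  right_inv a := rfl

/-- The octonionic coordinates on the graded piece of degree two, up to a scalar. -/
def coordsTwo {c : ℂ} (hc : c ≠ 0) : E 2 ≃ₗ[ℂ] ℂ × Oct × ℂ where
  toFun x := (c * (x : Jordan).1 2, c • Oct.conj ((x : Jordan).2 0), c * (x : Jordan).1 1)
  map_add' x y := by simp [mul_add]
  map_smul' a x := by
    simp only [SetLike.val_smul, Prod.smul_fst, Prod.smul_snd, Pi.smul_apply, map_smul, smul_eq_mul,
      RingHom.id_apply, Prod.smul_mk, smul_comm a c, mul_left_comm a c]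
  invFun a := ⟨c⁻¹ • deg2 a.2.2 (Oct.conj a.2.1) a.1,
    Submodule.smul_mem _ _ (mem_E_two.mpr ⟨_, _, _, rfl⟩)⟩
  left_inv x := by
    obtain ⟨x, hx⟩ := x
    obtain ⟨η, d, ζ, rfl⟩ := mem_E_two.mp hx
    apply Subtype.ext
    simp [deg2, Oct.conj_conj, hc]
  right_inv a := by
    obtain ⟨a, d, b⟩ := a
    simp [deg2, Oct.conj_conj, hc]

end E6

end

theorem mainTheorem8 (e₀ : Jordan) (he₀ : e₀ ∈ E6.E 0) (hne : e₀ ≠ 0) :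
    -- the isomorphism `α : 𝔼₁ ≃ 𝔲₋` given by the choice of `e₀`, inverse to `y ↦ y · e₀`
    ∃ α : E6.E 1 ≃ₗ[ℂ] E6.uMinus,
      (∀ x : E6.E 1, (α x : Module.End ℂ Jordan) e₀ = x) ∧
      -- `κ` is equivariant under `Spin₁₀`
      (∀ k ∈ E6.Spin10, ∀ x x' : E6.E 1, (x' : Jordan) = k x →
        (E6.kappa α x' : Jordan) = k (E6.kappa α x)) ∧
      -- the octonionic description of `κ`
      (∃ (φ₁ : E6.E 1 ≃ₗ[ℂ] Oct × Oct) (φ₂ : E6.E 2 ≃ₗ[ℂ] ℂ × Oct × ℂ),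
        ∀ (x : E6.E 1) (u v : Oct), φ₁ x = (u, v) →
          φ₂ (E6.kappa α x) = (u.norm, u.mul v, v.norm)) ∧
      (∀ x : E6.E 1, x ≠ 0 →
        (E6.HasRank (α x) 1 ↔ E6.kappa α x = 0) ∧
        (E6.HasRank (α x) 1 ↔
          Module.finrank ℂ (LinearMap.range (E6.lambda₂ (α x))) = 5) ∧
        (E6.HasRank (α x) 2 ↔
          Module.finrank ℂ (LinearMap.range (E6.lambda₂ (α x))) = 9)) ∧
      (∀ x y : E6.E 1, x ≠ 0 → y ≠ 0 →
        ((∀ a b : ℂ, (a, b) ≠ (0, 0) → E6.HasRank (α (a • x + b • y)) 2) →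
          Module.finrank ℂ
            ↥(LinearMap.ker (E6.lambda₂ (α x)) ⊓ LinearMap.ker (E6.lambda₂ (α y))) ≤ 3) ∧
        (E6.HasRank (α x) 1 → E6.HasRank (α y) 1 →
          4 ≤ Module.finrank ℂ
            ↥(LinearMap.range (E6.lambda₂ (α x)) ⊓ LinearMap.range (E6.lambda₂ (α y))) →
          ∃ c : ℂ, c ≠ 0 ∧ y = c • x)) := by
  obtain ⟨c, rfl⟩ := E6.mem_E_zero.mp he₀
  have hc : c ≠ 0 := by
    rintro rfl
    refine hne ?_
    apply Jordan.ext_coords <;> simp [Jordan.deg0]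
  have hmem : ∀ x : E6.E 1, c⁻¹ • (x : Jordan) ∈ E6.E 1 := fun x => Submodule.smul_mem _ _ x.2
  have hinj : ∀ x y : Jordan, c⁻¹ • x = c⁻¹ • y → x = y := fun x y h =>
    smul_right_injective _ (inv_ne_zero hc) h
  have hκ : ∀ x : E6.E 1, E6.lower (c⁻¹ • (x : Jordan)) (c⁻¹ • (x : Jordan)) = 0 ↔
      E6.kappa (E6.alphaEquiv hc) x = 0 := fun x => by
    rw [map_smul, ← E6.coe_kappa_alphaEquiv hc, smul_eq_zero, or_iff_right (inv_ne_zero hc),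
      ZeroMemClass.coe_eq_zero]
  have h1 : ∀ x : E6.E 1, E6.HasRank (E6.alphaEquiv hc x) 1 ↔ c⁻¹ • (x : Jordan) ≠ 0 ∧
      E6.lower (c⁻¹ • (x : Jordan)) (c⁻¹ • (x : Jordan)) = 0 := fun x =>
    E6.hasRank_one_iff_lower (hmem x) rfl
  have h2 : ∀ x : E6.E 1, E6.HasRank (E6.alphaEquiv hc x) 2 ↔
      E6.lower (c⁻¹ • (x : Jordan)) (c⁻¹ • (x : Jordan)) ≠ 0 := fun x =>
    E6.hasRank_two_iff_lower (hmem x) rfl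
  have h0 : ∀ x : E6.E 1, x ≠ 0 → c⁻¹ • (x : Jordan) ≠ 0 := fun x hx =>
    smul_ne_zero (inv_ne_zero hc) fun h => hx (Subtype.ext h)
  -- The scale c/2 in the coordinates on 𝔼₂ cancels the c⁻¹ in α and the 2 in ⟨x, x⟩ = 2N(x).
  refine ⟨E6.alphaEquiv hc, fun x => congrArg Subtype.val ((E6.alphaEquiv hc).symm_apply_apply x),
    fun k hk x x' hx => ?_, ⟨E6.coordsOne, E6.coordsTwo (div_ne_zero hc two_ne_zero), ?_⟩,
    fun x hx => ?_, fun x y hx hy => ⟨fun h => ?_, fun hx1 hy1 h => ?_⟩⟩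
  · obtain ⟨hK, h0⟩ := E6.Spin10_apply_deg0 hk
    rw [E6.coe_kappa_alphaEquiv, E6.coe_kappa_alphaEquiv, ← E6.lower_map hK h0 (hmem x), hx,
      map_smul k]
  · rintro ⟨x, hx⟩ u v huv
    obtain ⟨u', v', rfl⟩ := E6.mem_E_one.mp hx
    obtain ⟨rfl, rfl⟩ : u' = u ∧ v' = v := Prod.mk_inj.mp huv
    have hk := E6.coe_kappa_alphaEquiv hc ⟨Jordan.deg1 u' v', hx⟩
    rw [map_smul, LinearMap.smul_apply, E6.lower_lower] at hk
    change (c / 2 * (E6.kappa (E6.alphaEquiv hc) _ : Jordan).1 2,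
      (c / 2) • Oct.conj ((E6.kappa (E6.alphaEquiv hc) _ : Jordan).2 0),
      c / 2 * (E6.kappa (E6.alphaEquiv hc) _ : Jordan).1 1) = _
    rw [hk]
    simp only [Jordan.deg2, Prod.smul_fst, Prod.smul_snd, Pi.smul_apply, Matrix.cons_val, map_smul,
      Oct.conj_conj, smul_smul, smul_eq_mul]
    refine Prod.ext ?_ (Prod.ext ?_ ?_)
    · simp only
      field_simp
    · simp only
      rw [show c / 2 * (c⁻¹ * 2) = 1 by field_simp, one_smul]
    · simp only
      field_simp
  · rw [h1, h2, ← hκ, E6.finrank_range_lambda₂, E6.coe_alphaEquiv]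
    -- A nonzero x falls into exactly one of two cases, κ = 0 with λ₂ of rank 5, or κ ≠ 0 with λ₂ of
    -- rank 9. This settles all three equivalences at once.
    by_cases hz : E6.lower (c⁻¹ • (x : Jordan)) (c⁻¹ • (x : Jordan)) = 0
    · have := E6.finrank_map_lower_eq_five (hmem x) (h0 x hx) hz
      rw [this]
      exact ⟨and_iff_right (h0 x hx), iff_of_true ⟨h0 x hx, hz⟩ rfl,
        iff_of_false (fun h => h hz) (by norm_num)⟩
    · have := E6.finrank_map_lower_eq_nine (hmem x) hz
      rw [this]
      exact ⟨and_iff_right (h0 x hx), iff_of_false (fun h => hz h.2) (by norm_num),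
        iff_of_true hz rfl⟩
  · rw [E6.finrank_ker_inf_ker_lambda₂ (E6.coe_alphaEquiv hc x) (E6.coe_alphaEquiv hc y)]
    refine E6.finrank_commonKernel_le (hmem x) (hmem y) fun a b hab => ?_
    have := (h2 _).mp (h a b hab)
    rwa [Submodule.coe_add, Submodule.coe_smul, Submodule.coe_smul, smul_add, smul_comm c⁻¹ a,
      smul_comm c⁻¹ b] at this
  · rw [E6.finrank_range_inf_range_lambda₂, E6.coe_alphaEquiv, E6.coe_alphaEquiv] at h
    obtain ⟨d, hd⟩ := E6.eq_smul_of_finrank (hmem x) (hmem y) (h0 x hx) ((h1 x).mp hx1).2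
      ((h1 y).mp hy1).2 h
    have hyx : y = d • x := Subtype.ext (hinj _ _ (by rw [hd, smul_comm]; rfl))
    refine ⟨d, ?_, hyx⟩
    rintro rfl
    exact hy (by rw [hyx, zero_smul])
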